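/- Consider the plant $$x_{t+1}=Fx_t+Gu_t+w_t,\qquad y_t=Hx_t+v_t ,\qquad t=0,1,2,\dots$$ with real matrices, $\rho(F)>1$ and $(F,G)$ controllable, where $\rho$ is the spectral radius. The noises are bounded, $\|w_t\|_\infty<W/2$ and $\|v_t\|_\infty<V/2$ almost surely, and the initial state satisfies $\|x_0\|_\infty\le X_0$ almost surely, where $W,V,X_0$ are known constants. The pair $(F,H)$ is in block observable canonical form: $F=(F^{i,j})_{1\le i,j\le q}$ is block lower triangular, $F^{i,j}$ has size $\ell_i\times\ell_j$ with $\ell_i\ge 1$, and $$F^{i,i}=\begin{pmatrix}-a_{i,1}&1&&\\ \vdots&&\ddots&\\ -a_{i,\ell_i-1}&&&1\\ -a_{i,\ell_i}&0&\cdots&0\end{pmatrix},\qquad H=\begin{pmatrix}H_1\\H_2\end{pmatrix},\qquad H_1=\operatorname{blockdiag}\bigl([1\;0\cdots0]\in\mathbb R^{1\times\ell_i},\ i=1,\dots,q\bigr),$$ while the blocks of $F$ below the diagonal and the matrix $H_2$ are arbitrary. Let $|F|$ be the entrywise absolute value of $F$. There are $n\ge1$ uses of a binary-input causal channel per time step.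 At time $t$ an observer, which sees neither the control inputs nor the channel outputs, forms a $k$-bit message $b_t$ from $y_0,\dots,y_t$. A causal encoder maps $b_0,\dots,b_t$ to $n$ channel inputs. From the channel outputs up to time $t$ a decoder forms estimates $\hat b_{0|t},\dots,\hat b_{t|t}$ of $b_0,\dots,b_t$. A controller computes $u_{t+1}$ from the estimates $\hat b_{\tau|s}$, $\tau\le s\le t$, and $u_0$ is a fixed vector. The encoder-decoder pair is an $(R,\beta)$-anytime code over the channel if $R=k/n$ and there are constants $\eta$ and $d_o>0$ such that, for every random message process ($b_t$ may depend on past channel outputs, as it does in the loop), $$P\bigl(\min\{\tau\le t:\hat b_{\tau|t}\ne b_\tau\}=t-d+1\bigr)\le\eta\,2^{-n\beta d}\qquad\text{for all } t \text{ and all } d\ge d_o .$$ **Theorem.** Suppose that $$R>\frac1n\sum_{i=1}^q\max\Bigl\{0,\log_2\sum_{j=1}^{\ell_i}|a_{i,j}|\Bigr\},\qquad \beta>\frac2n\log_2\rho(|F|),$$ where $\log_2 0=-\infty$. Then the plant can be stabilized in mean square with an $(R,\beta)$-anytime code. That is, there are an observer and a controller such that, with every $(R,\beta)$-anytime code with $k$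 message bits and $n$ channel uses per time step, over any channel, and for all noises and initial states as above, the closed loop satisfies $\limsup_{t\to\infty}\mathbb E\|x_t\|^2<\infty$. -/

import Mathlib

open MeasureTheory ProbabilityTheory Filter
open scoped Matrix

universe u v

/-! ### The plant -/

/-- The state is indexed by pairs `⟨i, r⟩`: coordinate `r` of block `i`, block `i` having size `ℓ i`. -/
abbrev BlockIndex {q : ℕ} (ℓ : Fin q → ℕ) : Type := Σ i : Fin q, Fin (ℓ i)

/-- The entrywise absolute value of a real matrix. -/
def matrixAbs {ι κ : Type*} (A : Matrix ι κ ℝ) : Matrix ι κ ℝ := A.map fun r => |r|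

/-- The spectral radius of a real square matrix: the largest modulus of a complex eigenvalue. -/
noncomputable def matrixSpectralRadius {ι : Type*} [Fintype ι] [DecidableEq ι]
    (A : Matrix ι ι ℝ) : ℝ :=
  (spectralRadius ℂ (A.map (algebraMap ℝ ℂ))).toReal

/-- `(F, G)` is controllable: the Kalman matrix `[G, F G, …, F ^ (m - 1) G]` has full row rank `m`. -/
def IsControllable {ι υ : Type*} [Fintype ι] [DecidableEq ι] [Fintype υ]
    (F : Matrix ι ι ℝ) (G : Matrix ι υ ℝ) : Prop :=
  (Matrix.of fun (i : ι) (c : Fin (Fintype.card ι) × υ) => (F ^ (c.1 : ℕ) * G) i c.2).rank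
    = Fintype.card ι

/-- The block observable canonical form with coefficients `a i 0, …, a i (ℓ i - 1)` in block `i`.
`F` is block lower triangular; its `i`-th diagonal block has first column `-a i` and ones on the
superdiagonal. The first `q` measurements (before noise) are the first coordinates of the blocks;
the other `p` rows of `H`, and the blocks of `F` below the diagonal, are arbitrary. -/
structure IsBlockObservableForm {q p : ℕ} {ℓ : Fin q → ℕ} (a : (i : Fin q) → Fin (ℓ i) → ℝ)
    (F : Matrix (BlockIndex ℓ) (BlockIndex ℓ) ℝ)
    (H : Matrix (Fin q ⊕ Fin p) (BlockIndex ℓ) ℝ) : Prop where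
  size_pos : ∀ i, 0 < ℓ i
  upper_eq_zero : ∀ (i j : Fin q) (r : Fin (ℓ i)) (s : Fin (ℓ j)), i < j → F ⟨i, r⟩ ⟨j, s⟩ = 0
  diag_block : ∀ (i : Fin q) (r s : Fin (ℓ i)), F ⟨i, r⟩ ⟨i, s⟩ =
    if (s : ℕ) = 0 then -a i r else if (s : ℕ) = (r : ℕ) + 1 then 1 else 0
  measured : ∀ (i j : Fin q) (s : Fin (ℓ j)),
    H (Sum.inl i) ⟨j, s⟩ = if i = j ∧ (s : ℕ) = 0 then 1 else 0

/-! ### Channels, causal codes and anytime reliability -/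

/-- A `k`-bit message. -/
abbrev Message (k : ℕ) : Type := Fin k → Bool

/-- A causal channel with binary inputs and outputs in `Z`, used `n` times per time step.
`kernel t` gives the law of the `n` outputs at time `t`, given the inputs up to time `t` and the
outputs before time `t`. Memoryless channels are the case where only the last input matters. -/
structure CausalChannel (n : ℕ) (Z : Type v) [MeasurableSpace Z] where
  kernel : (t : ℕ) →
    Kernel ((Fin (t + 1) → Fin n → Bool) × (Fin t → Fin n → Z)) (Fin n → Z)
  markov : ∀ t, IsMarkovKernel (kernel t)

/-- A causal encoder-decoder pair with `k` message bits and `n` channel uses per time step.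
`encode t` maps `b_0, …, b_t` to the channel inputs `c_t`; `decode t` maps the channel outputs
`z_0, …, z_t` to estimates of `b_0, …, b_t`. -/
structure CausalCode (k n : ℕ) (Z : Type v) [MeasurableSpace Z] where
  encode : (t : ℕ) → (Fin (t + 1) → Message k) → Fin n → Bool
  decode : (t : ℕ) → (Fin (t + 1) → Fin n → Z) → Fin (t + 1) → Message k
  measurable_decode : ∀ t, Measurable (decode t)

/-- The messages `b` are encoded and sent over the channel, and `z` are the channel outputs: given
`b_0, …, b_t` and `z_0, …, z_{t-1}`, the outputs `z_t` have the law that the channel prescribes for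
the inputs `c_0, …, c_t`. The message `b_t` may depend on the outputs before time `t`, as
it does in a control loop. -/
structure IsTransmission {k n : ℕ} {Z : Type v} [MeasurableSpace Z] (ch : CausalChannel n Z)
    (code : CausalCode k n Z) {Ω : Type u} [MeasurableSpace Ω] (μ : Measure Ω)
    (b : ℕ → Ω → Message k) (z : ℕ → Ω → Fin n → Z) : Prop where
  measurable_message : ∀ t, Measurable (b t)
  measurable_output : ∀ t, Measurable (z t)
  output_law : ∀ (t : ℕ) (A : Set ((Fin (t + 1) → Message k) × (Fin t → Fin n → Z)))
    (B : Set (Fin n → Z)), MeasurableSet A → MeasurableSet B →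
    μ {ω | ((fun s : Fin (t + 1) => b s ω), (fun s : Fin t => z s ω)) ∈ A ∧ z t ω ∈ B} =
      ∫⁻ ω in {ω | ((fun s : Fin (t + 1) => b s ω), (fun s : Fin t => z s ω)) ∈ A},
        ch.kernel t
          ((fun s : Fin (t + 1) => code.encode s fun r : Fin ((s : ℕ) + 1) => b r ω),
            (fun s : Fin t => z s ω)) B ∂μ

/-- The times `τ ≤ t` whose message is estimated wrongly at time `t`. -/
def decodingErrors {k n : ℕ} {Z : Type v} [MeasurableSpace Z] (code : CausalCode k n Z)
    {Ω : Type u} (b : ℕ → Ω → Message k) (z : ℕ → Ω → Fin n → Z) (t : ℕ) (ω : Ω) : Set ℕ :=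
  {τ | ∃ h : τ < t + 1, code.decode t (fun s : Fin (t + 1) => z s ω) ⟨τ, h⟩ ≠ b τ ω}

/-- `(R, β, d₀)`-anytime reliability over a channel, for a code of rate `R = k / n`: whatever
messages are sent, the probability that at time `t` the earliest wrong estimate is the one of
`b_{t-d+1}` is at most `η 2 ^ (-n β d)`, for all `t` and all `d ≥ d₀`. -/
def IsAnytimeReliable {k n : ℕ} {Z : Type v} [MeasurableSpace Z] (ch : CausalChannel n Z)
    (code : CausalCode k n Z) (R β : ℝ) (d₀ : ℕ) : Prop :=
  R = (k : ℝ) / (n : ℝ) ∧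
  ∃ η : ℝ, ∀ (Ω : Type u) [MeasurableSpace Ω] (μ : Measure Ω) [IsProbabilityMeasure μ]
    (b : ℕ → Ω → Message k) (z : ℕ → Ω → Fin n → Z), IsTransmission ch code μ b z →
    ∀ t d : ℕ, d₀ ≤ d →
      μ {ω | ∃ τ : ℕ, IsLeast (decodingErrors code b z t ω) τ ∧ τ + d = t + 1} ≤
        ENNReal.ofReal (η * (2 : ℝ) ^ (-((n : ℝ) * β * (d : ℝ))))

/-- An `(R, β)`-anytime code: `(R, β, d₀)`-anytime reliable for some `d₀ > 0`. -/
def IsAnytimeCode {k n : ℕ} {Z : Type v} [MeasurableSpace Z] (ch : CausalChannel n Z)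
    (code : CausalCode k n Z) (R β : ℝ) : Prop :=
  ∃ d₀ : ℕ, 0 < d₀ ∧ IsAnytimeReliable.{u, v} ch code R β d₀

/-! ### The control loop -/

/-- An observer: the message `b_t` is a function of the measurements `y_0, …, y_t` only. -/
structure CausalObserver (k : ℕ) (κ : Type) where
  message : (t : ℕ) → (Fin (t + 1) → κ → ℝ) → Message k
  measurable_message : ∀ t, Measurable (message t)

/-- A controller: a fixed first input `u_0`, and the input `u_{t+1}` as a function of what the
decoder has put out at the times `0, …, t`. -/
structure CausalController (k : ℕ) (υ : Type) where
  first : υ → ℝ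
  next : (t : ℕ) → ((s : Fin (t + 1)) → Fin ((s : ℕ) + 1) → Message k) → υ → ℝ

/-- The closed loop formed by the plant `(F, G, H)` with process noise `w`, measurement noise `v`
and bounded initial state, the observer, the encoder, the channel, the decoder and the controller.
The norms are sup norms. -/
structure IsClosedLoop {k n : ℕ} {ι υ κ : Type} [Fintype ι] [Fintype υ] [Fintype κ]
    (F : Matrix ι ι ℝ) (G : Matrix ι υ ℝ) (H : Matrix κ ι ℝ) (X₀ W V : ℝ)
    (obs : CausalObserver k κ) (ctrl : CausalController k υ)
    {Z : Type v} [MeasurableSpace Z] (ch : CausalChannel n Z) (code : CausalCode k n Z)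
    {Ω : Type u} [MeasurableSpace Ω] (μ : Measure Ω)
    (w : ℕ → Ω → ι → ℝ) (v : ℕ → Ω → κ → ℝ) (x : ℕ → Ω → ι → ℝ) (y : ℕ → Ω → κ → ℝ)
    (u : ℕ → Ω → υ → ℝ) (b : ℕ → Ω → Message k) (z : ℕ → Ω → Fin n → Z) : Prop where
  measurable_init : Measurable (x 0)
  measurable_process_noise : ∀ t, Measurable (w t)
  measurable_measurement_noise : ∀ t, Measurable (v t)
  init_bound : ∀ᵐ ω ∂μ, ‖x 0 ω‖ ≤ X₀
  process_noise_bound : ∀ t, ∀ᵐ ω ∂μ, ‖w t ω‖ < W / 2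
  measurement_noise_bound : ∀ t, ∀ᵐ ω ∂μ, ‖v t ω‖ < V / 2
  state_eq : ∀ t ω, x (t + 1) ω = F *ᵥ x t ω + G *ᵥ u t ω + w t ω
  measurement_eq : ∀ t ω, y t ω = H *ᵥ x t ω + v t ω
  message_eq : ∀ t ω, b t ω = obs.message t fun s : Fin (t + 1) => y s ω
  transmission : IsTransmission ch code μ b z
  first_input_eq : ∀ ω, u 0 ω = ctrl.first
  next_input_eq : ∀ t ω, u (t + 1) ω = ctrl.next t fun s : Fin (t + 1) =>
    code.decode s fun r : Fin ((s : ℕ) + 1) => z r ω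

/-- Mean square stability: `limsup_t 𝔼 ‖x_t‖² < ∞`, with the Euclidean norm. -/
def IsMeanSquareStable {ι : Type} [Fintype ι] {Ω : Type u} [MeasurableSpace Ω] (μ : Measure Ω)
    (x : ℕ → Ω → ι → ℝ) : Prop :=
  limsup (fun t => ∫⁻ ω, ENNReal.ofReal (∑ i, x t ω i ^ 2) ∂μ) atTop < ⊤

/-! ### Growth of minors -/

/-! Time is cut into blocks of length T. By linearity the state is the response to the controls,
known to the controller, plus an uncontrolled part that follows A = F^T from block to block up to
bounded noise. From the outputs of a block the observer forms a reading: the uncontrolled state at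
the start of the block, plus a known effect of the controls, plus bounded noise. It rounds the
reading to a cell of side D and spends the next block sending the colour of the cell, one of 2^(kT).
If earlier colours are right, the cell lies in a translate, known to the controller, of A(box) +
box. It is identified as soon as no translate contains two cells of one colour. The colour belongs
to the absolute cell, so the observer needs neither the controls nor the channel outputs.

A greedy colouring exists if A(box) + box has fewer than 2^(kT) lattice points. Their number is at
most a constant times the largest maximal minor of [A, 1] (`card_lattice_le`). Such a minor is an
alternating form in columns of F^T, and each factor F costs at most ∏ c i, where c i ≥ 1 bounds a
weighted sum over column i of |F|: alternation charges each column at most once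
(`exists_det_pow_bound`). In the canonical form, suitable weights bring ∏ c i arbitrarily close to ∏
max(1, ∑ⱼ |a i j|) (`exists_weights`), which the rate condition puts below 2^k.

The controller recomputes all estimates from the latest decoded messages. A wrong colour moves an
estimate only boundedly away from its prediction, so errors reaching back δ steps cost at most a
constant times r^δ, with r just above ρ(|F|) (`exists_estimate_error_bound`). As r^2 < 2^(nβ),
anytime reliability bounds the mean of r^(2δ) (`exists_moment_bound`), hence that of the squared
state. -/

theorem alternating_comp_bound {ι J : Type*} [Fintype ι] [DecidableEq ι] [Fintype J]
    (F : Matrix ι ι ℝ) (w c : ι → ℝ) (hw : ∀ i, 0 < w i) (hc1 : ∀ i, 1 ≤ c i)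
    (hc : ∀ i, ∑ r, |F r i| * w r ≤ c i * w i)
    (ω : (ι → ℝ) [⋀^J]→ₗ[ℝ] ℝ) (B : ℝ)
    (hB : ∀ h : J → ι, |ω fun a => Pi.single (h a) 1| ≤ B * ∏ a, w (h a)) (h : J → ι) :
    |ω fun a => F *ᵥ Pi.single (h a) 1| ≤ (∏ i, c i) * B * ∏ a, w (h a) := by
  classical
  have hwpos : 0 < ∏ a, w (h a) := Finset.prod_pos fun a _ => hw _
  have hB0 : 0 ≤ B := by
    by_contra hlt
    have := (abs_nonneg _).trans (hB h)
    nlinarith [not_le.mp hlt]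
  have hγ : 0 ≤ ∏ i, c i := Finset.prod_nonneg fun i _ => zero_le_one.trans (hc1 i)
  by_cases hinj : Function.Injective h
  · have hexp : (fun a => F *ᵥ Pi.single (h a) 1) =
        fun a => ∑ r, F r (h a) • (Pi.single r 1 : ι → ℝ) := by
      ext a i
      simp [Finset.sum_apply, Pi.single_apply]
    have : ω (fun a => F *ᵥ Pi.single (h a) 1) =
        ∑ f : J → ι, (∏ a, F (f a) (h a)) * ω fun a => Pi.single (f a) 1 := by
      rw [hexp]
      change ω.toMultilinearMap _ = _
      rw [MultilinearMap.map_sum]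
      refine Finset.sum_congr rfl fun f _ => ?_
      rw [MultilinearMap.map_smul_univ]
      rfl
    rw [this]
    calc |∑ f : J → ι, (∏ a, F (f a) (h a)) * ω fun a => Pi.single (f a) 1|
        ≤ ∑ f : J → ι, (∏ a, |F (f a) (h a)|) * (B * ∏ a, w (f a)) := by
          refine (Finset.abs_sum_le_sum_abs _ _).trans (Finset.sum_le_sum fun f _ => ?_)
          rw [abs_mul, Finset.abs_prod]
          exact mul_le_mul_of_nonneg_left (hB f) (Finset.prod_nonneg fun _ _ => abs_nonneg _)
      _ = B * ∏ a, ∑ r, |F r (h a)| * w r := by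
          rw [Finset.prod_univ_sum, Fintype.piFinset_univ, Finset.mul_sum]
          refine Finset.sum_congr rfl fun f _ => ?_
          rw [Finset.prod_mul_distrib]
          ring
      _ ≤ B * ∏ a, (c (h a) * w (h a)) := by
          refine mul_le_mul_of_nonneg_left (Finset.prod_le_prod (fun a _ => ?_) fun a _ => hc _) hB0
          exact Finset.sum_nonneg fun r _ => mul_nonneg (abs_nonneg _) (hw r).le
      -- Injectivity of `h` makes each `c i` occur at most once; the missing factors are then added
      -- because they are at least 1.
      _ = B * ((∏ i ∈ Finset.univ.image h, c i) * ∏ a, w (h a)) := by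
          rw [Finset.prod_mul_distrib, Finset.prod_image fun a _ b _ hab => hinj hab]
      _ ≤ B * ((∏ i, c i) * ∏ a, w (h a)) := by
          refine mul_le_mul_of_nonneg_left (mul_le_mul_of_nonneg_right ?_ hwpos.le) hB0
          rw [← Finset.prod_sdiff (Finset.subset_univ (Finset.univ.image h))]
          exact le_mul_of_one_le_left (Finset.prod_nonneg fun i _ => zero_le_one.trans (hc1 i))
            (Finset.one_le_prod fun i _ => hc1 i)
      _ = _ := by ring
  · obtain ⟨a, b, hab, hne⟩ : ∃ a b, h a = h b ∧ a ≠ b := by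
      simpa [Function.Injective] using hinj
    rw [ω.map_eq_zero_of_eq _ (i := a) (j := b) (by simp [hab]) hne, abs_zero]
    positivity

/-- Composing the form with F preserves the shape of the bound and only multiplies B by ∏ c i, so
the one-step bound iterates. -/
theorem alternating_pow_bound {ι J : Type*} [Fintype ι] [DecidableEq ι] [Fintype J]
    (F : Matrix ι ι ℝ) (w c : ι → ℝ) (hw : ∀ i, 0 < w i) (hc1 : ∀ i, 1 ≤ c i)
    (hc : ∀ i, ∑ r, |F r i| * w r ≤ c i * w i) (T : ℕ)
    (ω : (ι → ℝ) [⋀^J]→ₗ[ℝ] ℝ) (B : ℝ)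
    (hB : ∀ h : J → ι, |ω fun a => Pi.single (h a) 1| ≤ B * ∏ a, w (h a)) (h : J → ι) :
    |ω fun a => (F ^ T) *ᵥ Pi.single (h a) 1| ≤ (∏ i, c i) ^ T * B * ∏ a, w (h a) := by
  induction T generalizing ω B with
  | zero =>
    simp only [pow_zero, one_mul, Matrix.one_mulVec]
    exact hB h
  | succ T ih =>
    have := ih (ω.compLinearMap F.mulVecLin) ((∏ i, c i) * B)
      (fun h => alternating_comp_bound F w c hw hc1 hc ω B hB h)
    simp only [AlternatingMap.compLinearMap_apply, Matrix.mulVecLin_apply, Matrix.mulVec_mulVec,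
      ← pow_succ'] at this
    rwa [pow_succ (∏ i, c i), mul_assoc _ _ B]

/-- An alternating map in the arguments satisfying `P`, the other arguments being fixed. -/
def AlternatingMap.restrictArgs {ι V : Type*} [DecidableEq ι] [AddCommGroup V] [Module ℝ V]
    (ω : V [⋀^ι]→ₗ[ℝ] ℝ) (P : ι → Prop) [DecidablePred P] (z : {a // ¬ P a} → V) :
    V [⋀^{a // P a}]→ₗ[ℝ] ℝ :=
  { ω.toMultilinearMap.domDomRestrict P z with
    map_eq_zero_of_eq' := fun v i j hij hne => by
      refine ω.map_eq_zero_of_eq _ (i := i.1) (j := j.1) ?_ fun h => hne (Subtype.ext h)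
      simp [i.2, j.2, hij] }

/-- The columns of `A` and the unit vectors. -/
def columnOrUnit {ι : Type*} [DecidableEq ι] [Fintype ι] (A : Matrix ι ι ℝ) : ι ⊕ ι → ι → ℝ :=
  Sum.elim (fun i => A *ᵥ Pi.single i 1) fun i => Pi.single i 1

theorem exists_det_pow_bound {ι : Type*} [Fintype ι] [DecidableEq ι]
    (F : Matrix ι ι ℝ) (w c : ι → ℝ) (hw : ∀ i, 0 < w i) (hc1 : ∀ i, 1 ≤ c i)
    (hc : ∀ i, ∑ r, |F r i| * w r ≤ c i * w i) :
    ∃ C : ℝ, ∀ (T : ℕ) (f : ι → ι ⊕ ι),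
      |(Matrix.of fun i => columnOrUnit (F ^ T) (f i)).det| ≤ C * (∏ i, c i) ^ T := by
  have hγ : 0 ≤ ∏ i, c i := Finset.prod_nonneg fun i _ => zero_le_one.trans (hc1 i)
  have key : ∀ f : ι → ι ⊕ ι, ∃ C : ℝ, 0 ≤ C ∧ ∀ T : ℕ,
      |(Matrix.of fun i => columnOrUnit (F ^ T) (f i)).det| ≤ C * (∏ i, c i) ^ T := by
    intro f
    let P : ι → Prop := fun i => (f i).isLeft = true
    let ω := (Matrix.detRowAlternating (n := ι) (R := ℝ)).restrictArgs P
      -- The frozen arguments are unit vectors, on which `columnOrUnit` ignores its matrix. The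
      -- restricted form, and with it B, is therefore the same for every T.
      fun a => columnOrUnit F (f a)
    let h : {a // P a} → ι := fun a => (f a).getLeft a.2
    let B : ℝ := ∑ g : {a // P a} → ι,
      |ω fun a => Pi.single (g a) 1| * (∏ a, w (g a))⁻¹
    have hterm : ∀ g : {a // P a} → ι, 0 ≤ |ω fun a => Pi.single (g a) 1| * (∏ a, w (g a))⁻¹ :=
      fun g => mul_nonneg (abs_nonneg _) (inv_nonneg.2 (Finset.prod_nonneg fun a _ => (hw _).le))
    have hB0 : 0 ≤ B := Finset.sum_nonneg fun g _ => hterm g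
    refine ⟨B * ∏ a, w (h a), mul_nonneg hB0 (Finset.prod_nonneg fun a _ => (hw _).le),
      fun T => ?_⟩
    have := alternating_pow_bound F w c hw hc1 hc T ω B (fun g => by
      have hpos : 0 < ∏ a, w (g a) := Finset.prod_pos fun a _ => hw _
      have := Finset.single_le_sum (fun g _ => hterm g) (Finset.mem_univ g)
      exact (mul_inv_le_iff₀ hpos).1 this) h
    convert this using 1
    · congr 1
      change _ = Matrix.det _
      congr 1
      ext i j
      by_cases hi : P i
      · obtain ⟨k, hk⟩ := Sum.isLeft_iff.1 hi
        simp [hi, columnOrUnit, hk, h]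
      · obtain ⟨k, hk⟩ := Sum.isRight_iff.1 (by simpa [P] using hi : (f i).isRight = true)
        simp [hi, columnOrUnit, hk]
    · ring
  choose C hC0 hC using key
  refine ⟨∑ f, C f, fun T f => (hC f T).trans ?_⟩
  exact mul_le_mul_of_nonneg_right
    (Finset.single_le_sum (fun f _ => hC0 f) (Finset.mem_univ f)) (pow_nonneg hγ T)

/-! ### Counting lattice points -/

/-- If all maximal minors of `[A, 1]` are at most `b` in absolute value, then few lattice points are
of the form `A x + y` with `x`, `y` in boxes. -/
theorem card_lattice_le {ι : Type*} [Fintype ι] [DecidableEq ι] (A : Matrix ι ι ℝ) (b : ℝ)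
    (hb : ∀ f : ι → ι ⊕ ι, |(Matrix.of fun i => columnOrUnit A (f i)).det| ≤ b)
    (S : Finset (ι → ℤ))
    (hS : ∀ Q ∈ S, ∃ x y : ι → ℝ, ‖x‖ ≤ 7 ∧ ‖y‖ ≤ 6 ∧ (fun i => (Q i : ℝ)) = A *ᵥ x + y) :
    (S.card : ℝ) ≤ b * (2 * (14 * Fintype.card ι)) ^ Fintype.card ι := by
  -- With the largest minor as basis, Cramer's rule writes every column of [A, 1] with coefficients
  -- of modulus at most 1. The choice of all unit vectors shows that this minor is nonzero.
  obtain ⟨f, -, hf⟩ := Finset.exists_max_image (Finset.univ : Finset (ι → ι ⊕ ι))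
    (fun f => |(Matrix.of fun i => columnOrUnit A (f i)).det|) ⟨fun i => Sum.inr i, by simp⟩
  have hunit : (Matrix.of fun i => columnOrUnit A (Sum.inr i : ι ⊕ ι)) = 1 := by
    ext i j
    simp [columnOrUnit, Pi.single_apply, Matrix.one_apply, eq_comm]
  set N : Matrix ι ι ℝ := (Matrix.of fun i => columnOrUnit A (f i))ᵀ with hN
  have hdetN : N.det = (Matrix.of fun i => columnOrUnit A (f i)).det := Matrix.det_transpose _
  have hNpos : 0 < |N.det| := by
    have := hf (fun i => Sum.inr i) (Finset.mem_univ _)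
    rw [hunit, Matrix.det_one, abs_one] at this
    rw [hdetN]
    linarith
  have hN0 : N.det ≠ 0 := abs_pos.1 hNpos
  have hcoef : ∀ j : ι ⊕ ι, ∃ α : ι → ℝ, ‖α‖ ≤ 1 ∧ N *ᵥ α = columnOrUnit A j := by
    intro j
    refine ⟨N.det⁻¹ • Matrix.cramer N (columnOrUnit A j), ?_, ?_⟩
    · refine (pi_norm_le_iff_of_nonneg zero_le_one).2 fun i => ?_
      have hup : N.updateCol i (columnOrUnit A j) =
          (Matrix.of fun i' => columnOrUnit A (Function.update f i j i'))ᵀ := by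
        ext r s
        by_cases hs : s = i
        · subst hs; simp
        · simp [hs, hN]
      have := hf (Function.update f i j) (Finset.mem_univ _)
      rw [Pi.smul_apply, Matrix.cramer_apply, hup, smul_eq_mul,
        Real.norm_eq_abs, abs_mul, abs_inv, inv_mul_le_iff₀ hNpos, mul_one, hdetN,
        Matrix.det_transpose]
      exact this
    · rw [Matrix.mulVec_smul, Matrix.mulVec_cramer, smul_smul, inv_mul_cancel₀ hN0, one_smul]
  choose α hα1 hα2 using hcoef
  set R : ℝ := 14 * Fintype.card ι
  have hR : 0 ≤ R := by positivity
  have hsub : ∀ x y : ι → ℝ, ‖x‖ ≤ 7 → ‖y‖ ≤ 7 →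
      A *ᵥ x + y ∈ N.mulVecLin '' Metric.closedBall 0 R := by
    intro x y hx hy
    refine ⟨∑ i, x i • α (Sum.inl i) + ∑ i, y i • α (Sum.inr i), ?_, ?_⟩
    · rw [mem_closedBall_zero_iff]
      have h1 : ∀ (x : ι → ℝ) (g : ι → ι ⊕ ι), ‖x‖ ≤ 7 →
          ‖∑ i, x i • α (g i)‖ ≤ 7 * Fintype.card ι := by
        intro x g hx
        refine (norm_sum_le_of_le _ (fun i _ => ?_) : _ ≤ ∑ _i : ι, (7 : ℝ)).trans
          (by simp [mul_comm])
        rw [norm_smul]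
        have := (norm_le_pi_norm x i).trans hx
        nlinarith [norm_nonneg (x i), norm_nonneg (α (g i)), hα1 (g i)]
      refine (norm_add_le _ _).trans ((add_le_add (h1 x _ hx) (h1 y _ hy)).trans ?_)
      simp only [R]
      linarith
    · simp only [map_add, map_sum, map_smul, Matrix.mulVecLin_apply, hα2]
      have hx' : x = ∑ i, x i • (Pi.single i 1 : ι → ℝ) := by
        ext j; simp [Finset.sum_apply, Pi.single_apply]
      have hy' : y = ∑ i, y i • (Pi.single i 1 : ι → ℝ) := by
        ext j; simp [Finset.sum_apply, Pi.single_apply]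
      conv_rhs => rw [hx', hy']
      simp [columnOrUnit, Matrix.mulVec_sum, Matrix.mulVec_smul]
  -- Volume comparison: disjoint unit cubes at the lattice points fit into a parallelepiped. The
  -- offset inside a cube raises the bound on y from 6 to 7.
  let cube : (ι → ℤ) → Set (ι → ℝ) := fun Q => Set.univ.pi fun i => Set.Ico (Q i : ℝ) (Q i + 1)
  have hdisj : (S : Set (ι → ℤ)).PairwiseDisjoint cube := by
    intro Q _ Q' _ hne
    refine Set.disjoint_left.2 fun p hp hp' => hne ?_
    ext i
    have h1 := hp i (Set.mem_univ i)
    have h2 := hp' i (Set.mem_univ i)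
    rw [← Int.floor_eq_iff.2 h1, ← Int.floor_eq_iff.2 h2]
  have hvol : volume (⋃ Q ∈ S, cube Q) = S.card := by
    rw [measure_biUnion_finset hdisj fun Q _ =>
      MeasurableSet.univ_pi fun i => measurableSet_Ico]
    simp [cube, Real.volume_pi_Ico]
  have hle : (⋃ Q ∈ S, cube Q) ⊆ N.mulVecLin '' Metric.closedBall 0 R := by
    refine Set.iUnion₂_subset fun Q hQ p hp => ?_
    obtain ⟨x, y, hx, hy, hxy⟩ := hS Q hQ
    have : p = A *ᵥ x + (y + (p - fun i => (Q i : ℝ))) := by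
      rw [← add_assoc, ← hxy]; abel
    rw [this]
    refine hsub _ _ hx ((norm_add_le _ _).trans ?_)
    have : ‖p - fun i => (Q i : ℝ)‖ ≤ 1 := by
      refine (pi_norm_le_iff_of_nonneg zero_le_one).2 fun i => ?_
      have := hp i (Set.mem_univ i)
      rw [Pi.sub_apply, Real.norm_eq_abs, abs_le]
      constructor <;> linarith [this.1, this.2]
    linarith
  have hfin := measure_mono (μ := volume) hle
  rw [hvol, Measure.addHaar_image_linearMap, Real.volume_pi_closedBall _ hR,
    ← Matrix.toLin'_apply', LinearMap.det_toLin', ← ENNReal.ofReal_mul (abs_nonneg _),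
    ← ENNReal.ofReal_natCast, ENNReal.ofReal_le_ofReal_iff (by positivity)] at hfin
  refine hfin.trans (mul_le_mul_of_nonneg_right ?_ (by positivity))
  rw [hdetN]
  exact hb f

/-! ### Greedy colouring -/

/-- Along an enumeration, each vertex has only finitely many predecessors, and those related to it
use fewer colours than there are. -/
theorem exists_coloring_of_degree_lt {X C : Type*} [Countable X] [Fintype C]
    (r : X → X → Prop)
    (hdeg : ∀ (x : X) (S : Finset X), (∀ y ∈ S, r y x) → S.card < Fintype.card C) :
    ∃ col : X → C, ∀ x y, x ≠ y → r x y → r y x → col x ≠ col y := by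
  classical
  obtain ⟨e, he⟩ := exists_injective_nat X
  have hex : ∀ (x : X) (g : ∀ y, e y < e x → C), ∃ c : C, ∀ y (h : e y < e x), r y x → g y h ≠ c := by
    intro x g
    have hfin : {y | e y < e x ∧ r y x}.Finite :=
      ((Set.finite_Iio (e x)).preimage he.injOn).subset fun y hy => hy.1
    let S := hfin.toFinset
    have hS : ∀ y ∈ S, e y < e x ∧ r y x := fun y hy => by simpa [S] using hy
    let I : Finset C := S.attach.image fun y => g y.1 (hS y.1 y.2).1
    have hI : I.card < Fintype.card C := by
      refine (Finset.card_image_le.trans_eq (Finset.card_attach)).trans_lt ?_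
      exact hdeg x S fun y hy => (hS y hy).2
    obtain ⟨c, hc⟩ : ∃ c, c ∉ I := by
      by_contra hall
      push Not at hall
      rw [Finset.eq_univ_iff_forall.2 hall] at hI
      exact lt_irrefl _ hI
    refine ⟨c, fun y h hr hgc => hc ?_⟩
    refine Finset.mem_image.2 ⟨⟨y, by simp [S, h, hr]⟩, Finset.mem_attach _ _, hgc⟩
  choose next hnext using hex
  let wf : WellFounded fun x y : X => e x < e y := (measure e).wf
  let col : X → C := wf.fix fun x g => next x fun y h => g y h
  have hcol : ∀ x, col x = next x fun y _ => col y := fun x => wf.fix_eq _ x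
  refine ⟨col, fun x y hne hxy hyx => ?_⟩
  rcases lt_trichotomy (e x) (e y) with h | h | h
  · have := hnext y (fun y _ => col y) x h hxy
    rwa [← hcol] at this
  · exact absurd (he h) hne
  · have := hnext x (fun y _ => col y) y h hyx
    rw [← hcol] at this
    exact this.symm

/-- For large `T`, the lattice points can be coloured with `M ^ T` colours so that distinct points
with the same colour do not both lie in a translate of the image of a box under `F ^ T`, fattened. -/
theorem exists_lattice_coloring {ι : Type*} [Fintype ι] [DecidableEq ι]
    (F : Matrix ι ι ℝ) (w c : ι → ℝ) (hw : ∀ i, 0 < w i) (hc1 : ∀ i, 1 ≤ c i)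
    (hc : ∀ i, ∑ r, |F r i| * w r ≤ c i * w i) (M : ℝ) (hM : ∏ i, c i < M) :
    ∀ᶠ T in atTop, ∀ (C : Type) [Fintype C], (Fintype.card C : ℝ) = M ^ T →
      ∃ col : (ι → ℤ) → C, ∀ P Q : ι → ℤ, col P = col Q →
        (∃ x y : ι → ℝ, ‖x‖ ≤ 7 ∧ ‖y‖ ≤ 6 ∧ (fun i => (P i : ℝ) - Q i) = (F ^ T) *ᵥ x + y) →
        P = Q := by
  have hγ : 1 ≤ ∏ i, c i := Finset.one_le_prod fun i _ => hc1 i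
  obtain ⟨B, hB⟩ := exists_det_pow_bound F w c hw hc1 hc
  set K : ℝ := B * (2 * (14 * Fintype.card ι)) ^ Fintype.card ι
  have hlim : Tendsto (fun T : ℕ => K * ((∏ i, c i) / M) ^ T) atTop (nhds (K * 0)) :=
    (tendsto_pow_atTop_nhds_zero_of_lt_one (div_nonneg (by linarith) (by linarith))
      ((div_lt_one (by linarith)).2 hM)).const_mul K
  filter_upwards [hlim.eventually_lt_const (by simp : K * 0 < 1)] with T hT C _ hC
  have hMT : (0 : ℝ) < M ^ T := pow_pos (by linarith) T
  have hKT : K * (∏ i, c i) ^ T < M ^ T := by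
    rw [div_pow, ← mul_div_assoc, div_lt_one hMT] at hT
    exact hT
  obtain ⟨col, hcol⟩ := exists_coloring_of_degree_lt (X := ι → ℤ) (C := C)
    (fun P Q => ∃ x y : ι → ℝ, ‖x‖ ≤ 7 ∧ ‖y‖ ≤ 6 ∧
      (fun i => (P i : ℝ) - Q i) = (F ^ T) *ᵥ x + y) (by
    intro P S hS
    have := card_lattice_le (F ^ T) _ (hB T) (S.image fun Q => Q - P) (by
      intro Q hQ
      obtain ⟨Q', hQ', rfl⟩ := Finset.mem_image.1 hQ
      simpa using hS Q' hQ')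
    rw [Finset.card_image_of_injective _ sub_left_injective] at this
    have h2 : (S.card : ℝ) < Fintype.card C := by
      rw [hC]
      refine this.trans_lt (lt_of_eq_of_lt ?_ hKT)
      simp only [K]; ring
    exact_mod_cast h2)
  refine ⟨col, fun P Q hPQ h => by_contra fun hne => hcol P Q hne h ?_ hPQ⟩
  obtain ⟨x, y, hx, hy, hxy⟩ := h
  refine ⟨-x, -y, by rwa [norm_neg], by rwa [norm_neg], ?_⟩
  rw [Matrix.mulVec_neg, ← neg_add, ← hxy]
  ext i
  simp

/-! ### Spectral radius and growth of powers -/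

theorem abs_pow_apply_le {ι : Type*} [Fintype ι] [DecidableEq ι] (F : Matrix ι ι ℝ) (d : ℕ)
    (i j : ι) : |(F ^ d) i j| ≤ (matrixAbs F ^ d) i j := by
  induction d generalizing i j with
  | zero => by_cases h : i = j <;> simp [h]
  | succ d ih =>
    rw [pow_succ, pow_succ, Matrix.mul_apply, Matrix.mul_apply]
    refine (Finset.abs_sum_le_sum_abs _ _).trans (Finset.sum_le_sum fun l _ => ?_)
    rw [abs_mul]
    exact mul_le_mul_of_nonneg_right (ih i l) (abs_nonneg _)

open scoped Matrix.Norms.Operator in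
theorem spectralRadius_complexification_ne_top {ι : Type*} [Fintype ι] [DecidableEq ι]
    (F : Matrix ι ι ℝ) : spectralRadius ℂ (F.map (algebraMap ℝ ℂ)) ≠ ⊤ := by
  refine ne_top_of_le_ne_top ?_ (spectrum.spectralRadius_le_pow_nnnorm_pow_one_div ℂ _ 0)
  simp [ENNReal.mul_ne_top]

open scoped Matrix.Norms.Operator in
theorem norm_complexification_pow_le {ι : Type*} [Fintype ι] [DecidableEq ι]
    (F : Matrix ι ι ℝ) (d : ℕ) :
    ‖F.map (algebraMap ℝ ℂ) ^ d‖ ≤ ‖(matrixAbs F).map (algebraMap ℝ ℂ) ^ d‖ := by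
  have hmap : ∀ A : Matrix ι ι ℝ, A.map (algebraMap ℝ ℂ) ^ d = (A ^ d).map (algebraMap ℝ ℂ) :=
    fun A => (map_pow (algebraMap ℝ ℂ).mapMatrix A d).symm
  rw [hmap, hmap, Matrix.linfty_opNorm_def, Matrix.linfty_opNorm_def, NNReal.coe_le_coe]
  refine Finset.sup_mono_fun fun i _ => Finset.sum_le_sum fun j _ => ?_
  rw [← NNReal.coe_le_coe]
  simpa using (abs_pow_apply_le F d i j).trans (le_abs_self _)

open scoped Matrix.Norms.Operator in
-- Gelfand's formula, since |F^d| ≤ |F|^d entrywise and the row-sum norm is monotone in the moduli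
-- of the entries. It is what makes ρ(|F|) > 1.
theorem matrixSpectralRadius_le_matrixAbs {ι : Type*} [Fintype ι] [DecidableEq ι]
    (F : Matrix ι ι ℝ) : matrixSpectralRadius F ≤ matrixSpectralRadius (matrixAbs F) := by
  refine ENNReal.toReal_mono (spectralRadius_complexification_ne_top _) ?_
  refine le_of_tendsto_of_tendsto'
    (spectrum.pow_norm_pow_one_div_tendsto_nhds_spectralRadius (F.map (algebraMap ℝ ℂ)))
    (spectrum.pow_norm_pow_one_div_tendsto_nhds_spectralRadius
      ((matrixAbs F).map (algebraMap ℝ ℂ))) fun d => ?_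
  exact ENNReal.ofReal_le_ofReal
    (Real.rpow_le_rpow (norm_nonneg _) (norm_complexification_pow_le F d) (by positivity))

open scoped Matrix.Norms.Operator in
theorem exists_pow_mulVec_bound {ι : Type*} [Fintype ι] [DecidableEq ι] (F : Matrix ι ι ℝ) (r : ℝ)
    (hr : matrixSpectralRadius (matrixAbs F) < r) :
    ∃ C : ℝ, 1 ≤ C ∧ ∀ (d : ℕ) (v : ι → ℝ), ‖(F ^ d) *ᵥ v‖ ≤ C * r ^ d * ‖v‖ := by
  have hr0 : 0 < r := ENNReal.toReal_nonneg.trans_lt hr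
  set M := (matrixAbs F).map (algebraMap ℝ ℂ)
  have hlt : spectralRadius ℂ M < ENNReal.ofReal r :=
    (ENNReal.lt_ofReal_iff_toReal_lt (spectralRadius_complexification_ne_top _)).2 hr
  have hev : ∀ᶠ d : ℕ in atTop, ‖M ^ d‖ / r ^ d ≤ 1 := by
    filter_upwards [(spectrum.pow_norm_pow_one_div_tendsto_nhds_spectralRadius M).eventually_lt_const
      hlt, eventually_gt_atTop 0] with d hd hd0
    rw [ENNReal.ofReal_lt_ofReal_iff hr0] at hd
    rw [div_le_one (pow_pos hr0 d)]
    have := pow_le_pow_left₀ (Real.rpow_nonneg (norm_nonneg _) _) hd.le d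
    rwa [one_div, Real.rpow_inv_natCast_pow (norm_nonneg _) hd0.ne'] at this
  obtain ⟨C, hC⟩ : BddAbove (Set.range fun d : ℕ => ‖M ^ d‖ / r ^ d) :=
    (isBoundedUnder_of_eventually_le hev).bddAbove_range
  refine ⟨max 1 C, le_max_left _ _, fun d v => ?_⟩
  have h1 : ‖M ^ d‖ ≤ max 1 C * r ^ d :=
    (div_le_iff₀ (pow_pos hr0 d)).1 ((hC ⟨d, rfl⟩).trans (le_max_right _ _))
  have h2 : ‖F ^ d‖ ≤ ‖M ^ d‖ := by
    have hmap : M ^ d = (matrixAbs F ^ d).map (algebraMap ℝ ℂ) :=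
      (map_pow (algebraMap ℝ ℂ).mapMatrix _ d).symm
    rw [hmap, Matrix.linfty_opNorm_def, Matrix.linfty_opNorm_def, NNReal.coe_le_coe]
    refine Finset.sup_mono_fun fun i _ => Finset.sum_le_sum fun j _ => ?_
    rw [← NNReal.coe_le_coe]
    simpa using (abs_pow_apply_le F d i j).trans (le_abs_self _)
  exact (Matrix.linfty_opNorm_mulVec _ _).trans
    (mul_le_mul_of_nonneg_right (h2.trans h1) (norm_nonneg _))

theorem exists_growth_rate {ι : Type*} [Fintype ι] [DecidableEq ι] (F : Matrix ι ι ℝ) {n : ℕ}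
    (hn : 0 < n) (β : ℝ) (hF : 1 < matrixSpectralRadius F)
    (hβ : 2 / (n : ℝ) * Real.logb 2 (matrixSpectralRadius (matrixAbs F)) < β) :
    ∃ r C : ℝ, 1 < r ∧ r ^ 2 * (2 : ℝ) ^ (-((n : ℝ) * β)) < 1 ∧ 1 ≤ C ∧
      ∀ (d : ℕ) (v : ι → ℝ), ‖(F ^ d) *ᵥ v‖ ≤ C * r ^ d * ‖v‖ := by
  set ρ := matrixSpectralRadius (matrixAbs F)
  have hρ : 1 < ρ := hF.trans_le (matrixSpectralRadius_le_matrixAbs F)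
  have hn' : (0 : ℝ) < n := Nat.cast_pos.2 hn
  set θ : ℝ := (n : ℝ) * β / 2
  have hθ : Real.logb 2 ρ < θ := by
    rw [div_mul_eq_mul_div, div_lt_iff₀ hn'] at hβ
    simp only [θ]
    linarith
  have h2 : ρ < (2 : ℝ) ^ θ := (Real.logb_lt_iff_lt_rpow one_lt_two (by linarith)).1 hθ
  -- The room between ρ(|F|) and 2^(nβ/2) pays for the constant C and makes the second-moment series
  -- geometric.
  obtain ⟨r, hr1, hr2⟩ := exists_between h2
  obtain ⟨C, hC1, hC⟩ := exists_pow_mulVec_bound F r hr1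
  refine ⟨r, C, hρ.trans hr1, ?_, hC1, hC⟩
  have hsq : r ^ 2 < ((2 : ℝ) ^ θ) ^ 2 := pow_lt_pow_left₀ hr2 (by linarith) two_ne_zero
  rw [← Real.rpow_mul_natCast zero_le_two] at hsq
  have hθ2 : θ * (2 : ℕ) = (n : ℝ) * β := by simp [θ]
  rw [hθ2] at hsq
  rw [Real.rpow_neg zero_le_two, ← div_eq_mul_inv, div_lt_one (by positivity)]
  exact hsq

/-! ### Observability and controllability -/

theorem IsBlockObservableForm.mulVec_apply {q p : ℕ} {ℓ : Fin q → ℕ}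
    {a : (i : Fin q) → Fin (ℓ i) → ℝ} {F : Matrix (BlockIndex ℓ) (BlockIndex ℓ) ℝ}
    {H : Matrix (Fin q ⊕ Fin p) (BlockIndex ℓ) ℝ} (hFH : IsBlockObservableForm a F H)
    (x : BlockIndex ℓ → ℝ) (i : Fin q) (r s : Fin (ℓ i)) (hs : (s : ℕ) = r + 1)
    (h0 : ∀ t : Fin (ℓ i), (t : ℕ) = 0 → x ⟨i, t⟩ = 0)
    (hlow : ∀ j < i, ∀ t : Fin (ℓ j), x ⟨j, t⟩ = 0) : (F *ᵥ x) ⟨i, r⟩ = x ⟨i, s⟩ := by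
  rw [Matrix.mulVec, dotProduct, Finset.sum_eq_single (⟨i, s⟩ : BlockIndex ℓ)]
  · rw [hFH.diag_block, if_neg (by omega), if_pos hs, one_mul]
  · rintro ⟨j, t⟩ - hne
    rcases lt_trichotomy j i with h | rfl | h
    · rw [hlow j h t, mul_zero]
    · rw [hFH.diag_block]
      split_ifs with h1 h2
      · rw [h0 t h1, mul_zero]
      · exact absurd (by rw [Fin.ext (h2.trans hs.symm)]) hne
      · rw [zero_mul]
    · rw [hFH.upper_eq_zero i j r t h, zero_mul]
  · simp

/-- The measurements give the first coordinate of each block at all times. Once the earlier blocks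
vanish, F shifts the coordinates of a block, so the remaining ones vanish by induction. -/
theorem IsBlockObservableForm.eq_zero {q p : ℕ} {ℓ : Fin q → ℕ}
    {a : (i : Fin q) → Fin (ℓ i) → ℝ} {F : Matrix (BlockIndex ℓ) (BlockIndex ℓ) ℝ}
    {H : Matrix (Fin q ⊕ Fin p) (BlockIndex ℓ) ℝ} (hFH : IsBlockObservableForm a F H)
    (x : BlockIndex ℓ → ℝ) (hx : ∀ j : ℕ, H *ᵥ ((F ^ j) *ᵥ x) = 0) : x = 0 := by
  have hfirst : ∀ (i : Fin q) (t : Fin (ℓ i)) (j : ℕ), (t : ℕ) = 0 →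
      ((F ^ j) *ᵥ x) ⟨i, t⟩ = 0 := by
    intro i t j ht
    have := congrFun (hx j) (Sum.inl i)
    rw [Matrix.mulVec, dotProduct, Finset.sum_eq_single (⟨i, t⟩ : BlockIndex ℓ)] at this
    · simpa [hFH.measured, ht] using this
    · rintro ⟨i', s⟩ - hne
      rw [hFH.measured, if_neg, zero_mul]
      rintro ⟨rfl, hs⟩
      exact hne (by rw [Fin.ext (hs.trans ht.symm)])
    · simp
  have hall : ∀ (m : ℕ) (i : Fin q), (i : ℕ) = m → ∀ (s : ℕ) (t : Fin (ℓ i)) (j : ℕ), (t : ℕ) = s →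
      ((F ^ j) *ᵥ x) ⟨i, t⟩ = 0 := by
    intro m
    induction m using Nat.strong_induction_on with
    | _ m ihm =>
      intro i hi s
      induction s with
      | zero => exact fun t j ht => hfirst i t j ht
      | succ s ihs =>
        intro t j ht
        have hstep := hFH.mulVec_apply ((F ^ j) *ᵥ x) i ⟨s, by omega⟩ t ht
          (fun t' ht' => hfirst i t' j ht')
          (fun i' hi' t' => ihm i' (by rw [← hi]; exact hi') i' rfl t' t' j rfl)
        rw [← hstep, Matrix.mulVec_mulVec, ← pow_succ']
        exact ihs _ (j + 1) rfl
  ext ⟨i, t⟩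
  simpa using hall i i rfl t t 0 rfl

/-- The kernels of the N-step observability maps decrease in finite dimension, so they stabilize,
and the limit is zero. -/
theorem exists_observability_leftInverse {ι κ : Type*} [Fintype ι] [DecidableEq ι] [Fintype κ]
    (F : Matrix ι ι ℝ) (H : Matrix κ ι ℝ)
    (hobs : ∀ x : ι → ℝ, (∀ j : ℕ, H *ᵥ ((F ^ j) *ᵥ x) = 0) → x = 0) :
    ∃ (N : ℕ) (L : (Fin N → κ → ℝ) →ₗ[ℝ] (ι → ℝ)),
      ∀ x : ι → ℝ, L (fun j => H *ᵥ ((F ^ (j : ℕ)) *ᵥ x)) = x := by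
  let O : (N : ℕ) → (ι → ℝ) →ₗ[ℝ] (Fin N → κ → ℝ) := fun N =>
    LinearMap.pi fun j => H.mulVecLin ∘ₗ (F ^ (j : ℕ)).mulVecLin
  let K : ℕ →o (Submodule ℝ (ι → ℝ))ᵒᵈ :=
    { toFun := fun N => OrderDual.toDual (LinearMap.ker (O N))
      monotone' := fun M N hMN => by
        change LinearMap.ker (O N) ≤ LinearMap.ker (O M)
        intro x hx
        rw [LinearMap.mem_ker] at hx ⊢
        ext1 j
        exact congrFun hx (Fin.castLE hMN j) }
  obtain ⟨N, hN⟩ := IsArtinian.monotone_stabilizes K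
  have hker : LinearMap.ker (O N) = ⊥ := by
    rw [eq_bot_iff]
    intro x hx
    refine hobs x fun j => ?_
    have hx' : x ∈ LinearMap.ker (O (N + j + 1)) := by
      have h : LinearMap.ker (O N) = LinearMap.ker (O (N + j + 1)) := hN (N + j + 1) (by omega)
      rwa [← h]
    exact congrFun (LinearMap.mem_ker.1 hx') ⟨j, by omega⟩
  obtain ⟨L, hL⟩ := (O N).exists_leftInverse_of_injective hker
  exact ⟨N, L, fun x => LinearMap.congr_fun hL x⟩

theorem IsControllable.exists_rightInverse {ι υ : Type*} [Fintype ι] [DecidableEq ι] [Fintype υ]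
    {F : Matrix ι ι ℝ} {G : Matrix ι υ ℝ} (h : IsControllable F G) (T : ℕ)
    (hT : Fintype.card ι ≤ T) :
    ∃ S : (ι → ℝ) →ₗ[ℝ] (Fin T → υ → ℝ), ∀ x : ι → ℝ,
      ∑ j : Fin T, (F ^ (T - 1 - (j : ℕ))) *ᵥ (G *ᵥ S x j) = x := by
  classical
  let Φ : (Fin T → υ → ℝ) →ₗ[ℝ] (ι → ℝ) :=
    ∑ j : Fin T, (F ^ (T - 1 - (j : ℕ))).mulVecLin ∘ₗ G.mulVecLin ∘ₗ LinearMap.proj j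
  have hΦ : ∀ u, Φ u = ∑ j : Fin T, (F ^ (T - 1 - (j : ℕ))) *ᵥ (G *ᵥ u j) := fun u => by
    simp [Φ, LinearMap.sum_apply]
  have hsurj : LinearMap.range Φ = ⊤ := by
    rw [eq_top_iff]
    intro x _
    unfold IsControllable at h
    rw [Matrix.rank] at h
    have htop := Submodule.eq_top_of_finrank_eq (h.trans (Module.finrank_fintype_fun_eq_card ℝ).symm)
    obtain ⟨c, hc⟩ : x ∈ LinearMap.range (Matrix.mulVecLin _) := htop ▸ Submodule.mem_top
    -- The Kalman coefficients are applied in reversed time order; the steps beyond the dimension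
    -- get zero input.
    let u : ℕ → υ → ℝ := fun j => if hj : j < Fintype.card ι then fun l => c (⟨j, hj⟩, l) else 0
    refine ⟨fun j => u (T - 1 - j), ?_⟩
    rw [hΦ, Fin.sum_univ_eq_sum_range (fun j => (F ^ (T - 1 - j)) *ᵥ (G *ᵥ u (T - 1 - j))) T,
      Finset.sum_range_reflect (fun j => (F ^ j) *ᵥ (G *ᵥ u j)) T,
      ← Finset.sum_subset (Finset.range_subset_range.2 hT), Finset.sum_range, ← hc]
    · ext i
      rw [Finset.sum_apply, Matrix.mulVecLin_apply, Matrix.mulVec, dotProduct,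
        Fintype.sum_prod_type]
      refine Finset.sum_congr rfl fun j _ => ?_
      rw [Matrix.mulVec_mulVec]
      simp [Matrix.mulVec, dotProduct, u]
    · intro j _ hj
      have : u j = 0 := dif_neg (by simpa using hj)
      simp [this]
  obtain ⟨S, hS⟩ := Φ.exists_rightInverse_of_surjective hsurj
  exact ⟨S, fun x => by rw [← hΦ]; exact LinearMap.congr_fun hS x⟩

/-! ### The rate of a system in block observable form -/

/-- Weight ε^i on block i multiplies the blocks below the diagonal by positive powers of ε. At ε = 0
only the diagonal blocks remain: the first column of block i sums to ∑ⱼ |a i j| and every other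
column to 1. Continuity gives a small positive ε. The truncated exponent for r.1 < i.1 is harmless,
as F vanishes there. -/
theorem IsBlockObservableForm.exists_weights {q p : ℕ} {ℓ : Fin q → ℕ}
    {a : (i : Fin q) → Fin (ℓ i) → ℝ} {F : Matrix (BlockIndex ℓ) (BlockIndex ℓ) ℝ}
    {H : Matrix (Fin q ⊕ Fin p) (BlockIndex ℓ) ℝ} (hFH : IsBlockObservableForm a F H) (M : ℝ)
    (hM : ∏ i, max 1 (∑ j, |a i j|) < M) :
    ∃ w c : BlockIndex ℓ → ℝ, (∀ i, 0 < w i) ∧ (∀ i, 1 ≤ c i) ∧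
      (∀ i, ∑ r, |F r i| * w r ≤ c i * w i) ∧ ∏ i, c i < M := by
  let g : ℝ → BlockIndex ℓ → ℝ := fun ε i =>
    max 1 (∑ r : BlockIndex ℓ, |F r i| * ε ^ ((r.1 : ℕ) - (i.1 : ℕ)))
  have hcont : Continuous fun ε => ∏ i, g ε i := by fun_prop
  have hblock : ∀ (i : Fin q) (s : Fin (ℓ i)),
      ∑ r : BlockIndex ℓ, |F r ⟨i, s⟩| * (0 : ℝ) ^ ((r.1 : ℕ) - (i : ℕ)) = ∑ r, |F ⟨i, r⟩ ⟨i, s⟩| := by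
    intro i s
    rw [Fintype.sum_sigma, Finset.sum_eq_single i]
    · simp
    · intro j _ hne
      refine Finset.sum_eq_zero fun r _ => ?_
      rcases lt_or_gt_of_ne hne with h | h
      · simp [hFH.upper_eq_zero j i r s h]
      · have : (j : ℕ) - (i : ℕ) ≠ 0 := Nat.sub_ne_zero_of_lt h
        simp [this]
    · simp
  have hg0 : ∏ i, g 0 i = ∏ i, max 1 (∑ j, |a i j|) := by
    rw [Fintype.prod_sigma]
    refine Finset.prod_congr rfl fun i _ => ?_
    rw [Finset.prod_eq_single ⟨0, hFH.size_pos i⟩]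
    · simp only [g, hblock, hFH.diag_block]
      simp
    · intro s _ hs
      have hs0 : (s : ℕ) ≠ 0 := fun h => hs (Fin.ext h)
      simp only [g, hblock, hFH.diag_block, if_neg hs0]
      refine max_eq_left ?_
      rw [Finset.sum_eq_single ⟨(s : ℕ) - 1, by omega⟩]
      · split_ifs <;> simp
      · intro r _ hr
        rw [if_neg, abs_zero]
        intro h
        exact hr (Fin.ext (by simp [h]))
      · simp
    · simp
  have hev : ∀ᶠ ε in nhdsWithin (0 : ℝ) (Set.Ioi 0), ∏ i, g ε i < M :=
    (hcont.tendsto 0).mono_left nhdsWithin_le_nhds |>.eventually_lt_const (by rwa [hg0])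
  obtain ⟨ε, hε, hε0⟩ := (hev.and self_mem_nhdsWithin).exists
  have hε0 : 0 < ε := hε0
  refine ⟨fun i => ε ^ (i.1 : ℕ), g ε, fun i => pow_pos hε0 _, fun i => le_max_left _ _,
    fun i => ?_, hε⟩
  refine le_trans ?_ (mul_le_mul_of_nonneg_right (le_max_right _ _) (pow_pos hε0 _).le)
  rw [Finset.sum_mul]
  refine Finset.sum_le_sum fun r _ => ?_
  rcases lt_or_ge r.1 i.1 with h | h
  · rw [hFH.upper_eq_zero r.1 i.1 r.2 i.2 h]
    simp
  · rw [mul_assoc, ← pow_add, Nat.sub_add_cancel h]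

/-- The value `Real.logb 2 0 = 0` in place of -∞ is harmless under the maximum with 0. -/
theorem prod_max_one_lt_two_pow {q k n : ℕ} (hn : 0 < n) (S : Fin q → ℝ)
    (hR : 1 / (n : ℝ) * ∑ i, max 0 (Real.logb 2 (S i)) < (k : ℝ) / n) :
    ∏ i, max 1 (S i) < (2 : ℝ) ^ k := by
  have hn' : (0 : ℝ) < n := Nat.cast_pos.2 hn
  rw [one_div, inv_mul_eq_div, div_lt_div_iff_of_pos_right hn'] at hR
  have hpos : ∀ i, 0 < max 1 (S i) := fun i => lt_max_of_lt_left one_pos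
  have hlog : ∀ i, Real.logb 2 (max 1 (S i)) ≤ max 0 (Real.logb 2 (S i)) := by
    intro i
    rcases le_total 1 (S i) with h | h
    · rw [max_eq_right h]; exact le_max_right _ _
    · rw [max_eq_left h, Real.logb_one]; exact le_max_left _ _
  have : Real.logb 2 (∏ i, max 1 (S i)) < k := by
    rw [Real.logb_prod _ _ fun i _ => (hpos i).ne']
    exact (Finset.sum_le_sum fun i _ => hlog i).trans_lt hR
  rw [Real.logb_lt_iff_lt_rpow one_lt_two (Finset.prod_pos fun i _ => hpos i)] at this
  simpa using this

/-! ### Quantization and the state estimate -/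

theorem LinearMap.exists_norm_bound {V W : Type*} [NormedAddCommGroup V] [NormedSpace ℝ V]
    [FiniteDimensional ℝ V] [NormedAddCommGroup W] [NormedSpace ℝ W] (L : V →ₗ[ℝ] W) :
    ∃ C : ℝ, 0 ≤ C ∧ ∀ x, ‖L x‖ ≤ C * ‖x‖ :=
  ⟨‖L.toContinuousLinearMap‖, norm_nonneg _, fun x => L.toContinuousLinearMap.le_opNorm x⟩

theorem affine_iterate {ι : Type*} [Fintype ι] [DecidableEq ι] (F : Matrix ι ι ℝ)
    (x f : ℕ → ι → ℝ) (h : ∀ t, x (t + 1) = F *ᵥ x t + f t) (t j : ℕ) :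
    x (t + j) = (F ^ j) *ᵥ x t + ∑ i ∈ Finset.range j, (F ^ (j - 1 - i)) *ᵥ f (t + i) := by
  induction j with
  | zero => simp
  | succ j ih =>
    rw [← add_assoc, h, ih, Finset.sum_range_succ, Matrix.mulVec_add, Matrix.mulVec_mulVec,
      ← pow_succ', Matrix.mulVec_sum, ← add_assoc]
    simp only [Nat.add_sub_cancel, Nat.sub_self, pow_zero, Matrix.one_mulVec]
    congr 2
    refine Finset.sum_congr rfl fun i hi => ?_
    rw [Matrix.mulVec_mulVec, ← pow_succ']
    congr 2
    have := Finset.mem_range.1 hi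
    omega

/-- The index of the cell of side `D` that contains `z`. -/
noncomputable def quantize {ι : Type*} (D : ℝ) (z : ι → ℝ) : ι → ℤ := fun i => ⌊z i / D⌋

/-- The corner of the cell of side `D` with index `P`. -/
def dequantize {ι : Type*} (D : ℝ) (P : ι → ℤ) : ι → ℝ := fun i => D * P i

theorem norm_dequantize_quantize_sub_le {ι : Type*} [Fintype ι] {D : ℝ} (hD : 0 < D) (z : ι → ℝ) :
    ‖dequantize D (quantize D z) - z‖ ≤ D := by
  refine (pi_norm_le_iff_of_nonneg hD.le).2 fun i => ?_
  have h1 := Int.floor_le (z i / D)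
  have h2 := Int.lt_floor_add_one (z i / D)
  rw [le_div_iff₀ hD] at h1
  rw [div_lt_iff₀ hD] at h2
  simp only [Pi.sub_apply, dequantize, quantize, Real.norm_eq_abs, abs_le]
  constructor <;> nlinarith

/-- The cell `P` is within the uncertainty of a prediction `p`. -/
def IsCandidate {ι : Type*} [Fintype ι] (A : Matrix ι ι ℝ) (D : ℝ) (p : ι → ℝ) (P : ι → ℤ) : Prop :=
  ∃ x y : ι → ℝ, ‖x‖ ≤ 3 * D ∧ ‖y‖ ≤ 3 * D ∧ dequantize D P - p = A *ᵥ x + y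

/-- Distinct cells of the same colour are never candidates for the same prediction. -/
def Separates {ι C : Type*} [Fintype ι] (A : Matrix ι ι ℝ) (col : (ι → ℤ) → C) : Prop :=
  ∀ P Q : ι → ℤ, col P = col Q →
    (∃ x y : ι → ℝ, ‖x‖ ≤ 7 ∧ ‖y‖ ≤ 6 ∧ (fun i => (P i : ℝ) - Q i) = A *ᵥ x + y) → P = Q

theorem Separates.eq_of_isCandidate {ι C : Type*} [Fintype ι] {A : Matrix ι ι ℝ}
    {col : (ι → ℤ) → C} (h : Separates A col) {D : ℝ} (hD : 0 < D) {p : ι → ℝ} {P Q : ι → ℤ}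
    (hPQ : col P = col Q) (hP : IsCandidate A D p P) (hQ : IsCandidate A D p Q) : P = Q := by
  obtain ⟨x, y, hx, hy, hxy⟩ := hP
  obtain ⟨x', y', hx', hy', hxy'⟩ := hQ
  have hnorm : ∀ a b : ι → ℝ, ‖a‖ ≤ 3 * D → ‖b‖ ≤ 3 * D → ‖D⁻¹ • (a - b)‖ ≤ 6 := by
    intro a b ha hb
    rw [norm_smul, norm_inv, Real.norm_of_nonneg hD.le, inv_mul_le_iff₀ hD]
    linarith [norm_sub_le a b]
  -- Two candidates differ by vectors of norm at most 3D + 3D, which is 6 in units of D. The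
  -- prediction cancels, so separation for differences serves every prediction.
  refine h P Q hPQ ⟨D⁻¹ • (x - x'), D⁻¹ • (y - y'), (hnorm _ _ hx hx').trans (by norm_num),
    hnorm _ _ hy hy', ?_⟩
  have : dequantize D P - dequantize D Q = A *ᵥ (x - x') + (y - y') := by
    rw [Matrix.mulVec_sub]
    linear_combination hxy - hxy'
  rw [Matrix.mulVec_smul, ← smul_add, ← this]
  ext i
  simp only [dequantize, Pi.smul_apply, Pi.sub_apply, smul_eq_mul]
  field_simp

open scoped Classical in
/-- The candidate cell of colour `γ` for the prediction `p`, if there is one. -/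
noncomputable def decodeCell {ι C : Type*} [Fintype ι] (A : Matrix ι ι ℝ) (D : ℝ)
    (col : (ι → ℤ) → C) (p : ι → ℝ) (γ : C) : ι → ℤ :=
  if h : ∃ P, col P = γ ∧ IsCandidate A D p P then h.choose else quantize D p

theorem decodeCell_eq {ι C : Type*} [Fintype ι] {A : Matrix ι ι ℝ} {D : ℝ} (hD : 0 < D)
    {col : (ι → ℤ) → C} (h : Separates A col) {p : ι → ℝ} {P : ι → ℤ} (hP : IsCandidate A D p P) :
    decodeCell A D col p (col P) = P := by
  have hex : ∃ Q, col Q = col P ∧ IsCandidate A D p Q := ⟨P, rfl, hP⟩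
  rw [decodeCell, dif_pos hex]
  exact h.eq_of_isCandidate hD hex.choose_spec.1 hex.choose_spec.2 hP

/-- Holds for every colour, right or wrong: a candidate is near the prediction by definition, and
the default cell contains it. This is what limits the damage of decoding errors. -/
theorem norm_decodeCell_sub_le {ι C : Type*} [Fintype ι] {A : Matrix ι ι ℝ} {D : ℝ} (hD : 0 < D)
    (col : (ι → ℤ) → C) {c : ℝ} (hc : 0 ≤ c) (hA : ∀ x, ‖A *ᵥ x‖ ≤ c * ‖x‖) (p : ι → ℝ) (γ : C) :
    ‖dequantize D (decodeCell A D col p γ) - p‖ ≤ 3 * (c + 1) * D := by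
  by_cases hex : ∃ Q, col Q = γ ∧ IsCandidate A D p Q
  · rw [decodeCell, dif_pos hex]
    obtain ⟨x, y, hx, hy, hxy⟩ := hex.choose_spec.2
    rw [hxy]
    have := mul_le_mul_of_nonneg_left hx hc
    linarith [norm_add_le (A *ᵥ x) y, hA x]
  · rw [decodeCell, dif_neg hex]
    have := norm_dequantize_quantize_sub_le hD p
    nlinarith [mul_nonneg hc hD.le]

/-- The estimates of the uncontrolled state after successive blocks, from the colours `γ` of the
quantized measurements; `ζ` is the contribution of the controls to these measurements. -/
noncomputable def estimate {ι C : Type*} [Fintype ι] (A : Matrix ι ι ℝ) (D : ℝ)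
    (col : (ι → ℤ) → C) (ζ : ℕ → ι → ℝ) (γ : ℕ → C) : ℕ → ι → ℝ
  | 0 => 0
  | s + 1 => dequantize D (decodeCell A D col (ζ s + A *ᵥ estimate A D col ζ γ s) (γ s)) - ζ s

theorem estimate_congr {ι C : Type*} [Fintype ι] (A : Matrix ι ι ℝ) (D : ℝ)
    (col : (ι → ℤ) → C) {ζ ζ' : ℕ → ι → ℝ} (γ : ℕ → C) (s : ℕ) (h : ∀ i < s, ζ i = ζ' i) :
    estimate A D col ζ γ s = estimate A D col ζ' γ s := by
  induction s with
  | zero => rfl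
  | succ s ih => rw [estimate, estimate, ih fun i hi => h i (by omega), h s (by omega)]

/-- Entry s + 1 of `estimate` approximates X s within 2D: D from the reading and D from rounding.
One step of A and noise D give the form A a + b; the next reading and rounding raise b to the 3D
allowed in `IsCandidate`. The form is kept, rather than a norm, because the colouring separates
exactly such sets. -/
theorem estimate_error_correct {ι C : Type*} [Fintype ι] {A : Matrix ι ι ℝ} {D : ℝ} (hD : 0 < D)
    {col : (ι → ℤ) → C} (hcol : Separates A col) (ζ z X : ℕ → ι → ℝ) (γ : ℕ → C)
    (hX0 : ‖X 0‖ ≤ D) (hX : ∀ s, ‖X (s + 1) - A *ᵥ X s‖ ≤ D)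
    (hz : ∀ s, ‖z s - ζ s - X s‖ ≤ D) (s : ℕ) (hγ : ∀ i < s, γ i = col (quantize D (z i))) :
    ∃ a b : ι → ℝ, ‖a‖ ≤ 2 * D ∧ ‖b‖ ≤ D ∧ X s - A *ᵥ estimate A D col ζ γ s = A *ᵥ a + b := by
  induction s with
  | zero => exact ⟨0, X 0, by simpa using hD.le, hX0, by simp [estimate]⟩
  | succ s ih =>
    obtain ⟨a, b, ha, hb, hab⟩ := ih fun i hi => hγ i (by omega)
    have hq := norm_dequantize_quantize_sub_le hD (z s)
    set P := quantize D (z s)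
    have hcand : IsCandidate A D (ζ s + A *ᵥ estimate A D col ζ γ s) P := by
      refine ⟨a, (dequantize D P - z s) + (z s - ζ s - X s) + b, by linarith, ?_, ?_⟩
      · refine (norm_add₃_le).trans ?_
        linarith [hz s]
      · linear_combination hab
    have hest : estimate A D col ζ γ (s + 1) = dequantize D P - ζ s := by
      rw [estimate, hγ s (by omega), decodeCell_eq hD hcol hcand]
    refine ⟨X s - estimate A D col ζ γ (s + 1), X (s + 1) - A *ᵥ X s, ?_, hX s, ?_⟩
    · have : X s - estimate A D col ζ γ (s + 1) =
          -((dequantize D P - z s) + (z s - ζ s - X s)) := by rw [hest]; abel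
      rw [this, norm_neg]
      linarith [norm_add_le (dequantize D P - z s) (z s - ζ s - X s), hz s]
    · rw [Matrix.mulVec_sub]; abel

/-- If the first `j` colours are right, the error of the prediction `d` blocks later is at most a
constant times `ρ ^ d`, where `ρ` is a growth rate of the powers of `A`. -/
theorem exists_estimate_error_bound {ι C : Type*} [Fintype ι] [DecidableEq ι] {A : Matrix ι ι ℝ}
    {D : ℝ} (hD : 0 < D) {col : (ι → ℤ) → C} (hcol : Separates A col) {c ρ : ℝ} (hc : 0 ≤ c)
    (hρ : 1 < ρ) (hA : ∀ (d : ℕ) (x : ι → ℝ), ‖(A ^ d) *ᵥ x‖ ≤ c * ρ ^ d * ‖x‖) :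
    ∃ K : ℝ, 0 ≤ K ∧ ∀ (ζ z X : ℕ → ι → ℝ) (γ : ℕ → C), ‖X 0‖ ≤ D →
      (∀ s, ‖X (s + 1) - A *ᵥ X s‖ ≤ D) → (∀ s, ‖z s - ζ s - X s‖ ≤ D) →
      ∀ j d : ℕ, (∀ i < j, γ i = col (quantize D (z i))) →
        ‖X (j + d) - A *ᵥ estimate A D col ζ γ (j + d)‖ ≤ K * ρ ^ d := by
  set c1 := c * ρ
  have hc1 : 0 ≤ c1 := mul_nonneg hc (by linarith)
  have hA1 : ∀ x, ‖A *ᵥ x‖ ≤ c1 * ‖x‖ := fun x => by simpa using hA 1 x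
  set B1 := c1 * (2 * D) + D
  set B2 := D + c1 * (3 * (c1 + 1) * D)
  have hB1 : 0 ≤ B1 := by positivity
  have hB2 : 0 ≤ B2 := by positivity
  have hρ1 : 0 < ρ - 1 := by linarith
  have hρ0 : 0 < ρ := by linarith
  refine ⟨c * B1 + c * B2 / (ρ - 1), by positivity, fun ζ z X γ hX0 hX hz j d hγ => ?_⟩
  set E : ℕ → ι → ℝ := fun s => X s - A *ᵥ estimate A D col ζ γ s
  -- The prediction error obeys E (s + 1) = A E s + f s with f bounded whatever the colours.
  -- Starting from the bounded E j, d steps give a geometric sum of order ρ^d.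
  set f : ℕ → ι → ℝ := fun s => E (s + 1) - A *ᵥ E s
  have hf : ∀ s, ‖f s‖ ≤ B2 := by
    intro s
    set κ := dequantize D (decodeCell A D col (ζ s + A *ᵥ estimate A D col ζ γ s) (γ s)) -
      (ζ s + A *ᵥ estimate A D col ζ γ s) with hκ
    have hκn : ‖κ‖ ≤ 3 * (c1 + 1) * D := norm_decodeCell_sub_le hD col hc1 hA1 _ _
    have hfs : f s = (X (s + 1) - A *ᵥ X s) - A *ᵥ κ := by
      have : estimate A D col ζ γ (s + 1) = A *ᵥ estimate A D col ζ γ s + κ := by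
        rw [hκ, estimate]; abel
      simp only [f, E, this, Matrix.mulVec_sub, Matrix.mulVec_add]
      abel
    rw [hfs]
    refine (norm_sub_le _ _).trans (add_le_add (hX s) ((hA1 κ).trans ?_))
    exact mul_le_mul_of_nonneg_left hκn hc1
  have hE : ‖E j‖ ≤ B1 := by
    obtain ⟨a, b, ha, hb, hab⟩ := estimate_error_correct hD hcol ζ z X γ hX0 hX hz j hγ
    simp only [E, hab]
    refine (norm_add_le _ _).trans (add_le_add ((hA1 a).trans ?_) hb)
    exact mul_le_mul_of_nonneg_left ha hc1
  have hiter := affine_iterate A E f (fun t => by simp only [f]; abel) j d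
  change ‖E (j + d)‖ ≤ _
  rw [hiter]
  have hsum : ‖∑ i ∈ Finset.range d, (A ^ (d - 1 - i)) *ᵥ f (j + i)‖ ≤
      c * B2 / (ρ - 1) * ρ ^ d := by
    calc _ ≤ ∑ i ∈ Finset.range d, c * ρ ^ (d - 1 - i) * B2 :=
          norm_sum_le_of_le _ fun i _ => (hA _ _).trans
            (mul_le_mul_of_nonneg_left (hf _) (by positivity))
      _ = c * B2 * ∑ i ∈ Finset.range d, ρ ^ i := by
          rw [Finset.sum_range_reflect (fun i => c * ρ ^ i * B2), Finset.mul_sum]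
          exact Finset.sum_congr rfl fun i _ => by ring
      _ = c * B2 * ((ρ ^ d - 1) / (ρ - 1)) := by rw [geom_sum_eq hρ.ne']
      _ ≤ c * B2 * (ρ ^ d / (ρ - 1)) := by
          refine mul_le_mul_of_nonneg_left ?_ (by positivity)
          exact div_le_div_of_nonneg_right (by linarith) hρ1.le
      _ = _ := by ring
  have hfirst : ‖(A ^ d) *ᵥ E j‖ ≤ c * B1 * ρ ^ d := by
    refine (hA d _).trans ((mul_le_mul_of_nonneg_left hE (by positivity)).trans_eq (by ring))
  rw [add_mul]
  exact (norm_add_le _ _).trans (add_le_add hfirst hsum)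

/-! ### The controller -/

/-- The response of the plant to the inputs `u` from the zero state. -/
def controlResponse {ι υ : Type*} [Fintype ι] [Fintype υ] (F : Matrix ι ι ℝ) (G : Matrix ι υ ℝ)
    (u : ℕ → υ → ℝ) : ℕ → ι → ℝ
  | 0 => 0
  | t + 1 => F *ᵥ controlResponse F G u t + G *ᵥ u t

theorem controlResponse_congr {ι υ : Type*} [Fintype ι] [Fintype υ] (F : Matrix ι ι ℝ)
    (G : Matrix ι υ ℝ) {u u' : ℕ → υ → ℝ} (t : ℕ) (h : ∀ i < t, u i = u' i) :
    controlResponse F G u t = controlResponse F G u' t := by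
  induction t with
  | zero => rfl
  | succ t ih =>
    rw [controlResponse, controlResponse, ih fun i hi => h i (by omega), h t (by omega)]

/-- The fixed point of a strictly causal map of sequences. -/
noncomputable def causalFix {E : Type*} [Zero E] (Φ : (ℕ → E) → ℕ → E) (t : ℕ) : E :=
  Φ (fun s => if s < t then causalFix Φ s else 0) t

theorem causalFix_eq {E : Type*} [Zero E] {Φ : (ℕ → E) → ℕ → E}
    (hΦ : ∀ u u' t, (∀ s < t, u s = u' s) → Φ u t = Φ u' t) (t : ℕ) :
    causalFix Φ t = Φ (causalFix Φ) t := by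
  rw [causalFix]
  exact hΦ _ _ _ fun s hs => by rw [if_pos hs]

theorem causalFix_congr {E : Type*} [Zero E] {Φ Ψ : (ℕ → E) → ℕ → E}
    (hΦ : ∀ u u' t, (∀ s < t, u s = u' s) → Φ u t = Φ u' t) (t : ℕ)
    (h : ∀ u, ∀ s ≤ t, Φ u s = Ψ u s) : causalFix Φ t = causalFix Ψ t := by
  induction t using Nat.strong_induction_on with
  | _ t ih =>
    rw [causalFix, causalFix, ← h _ t le_rfl]
    refine hΦ _ _ _ fun s hs => ?_
    rw [if_pos hs, if_pos hs]
    exact ih s hs fun u i hi => h u i (by omega)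

/-- The parameters of the observer and of the controller: the block length `T`, the cell size `D`,
the colouring of the cells, a left inverse `L` of the observability map over `N` steps, and a right
inverse `S` of the controllability map over a block. -/
structure LoopDesign (k : ℕ) (ι υ κ : Type) where
  N : ℕ
  T : ℕ
  T_pos : 0 < T
  N_le : N ≤ T
  D : ℝ
  D_pos : 0 < D
  col : (ι → ℤ) → Fin T → Message k
  L : (Fin N → κ → ℝ) →ₗ[ℝ] (ι → ℝ)
  S : (ι → ℝ) →ₗ[ℝ] (Fin T → υ → ℝ)

namespace LoopDesign

variable {k : ℕ} {ι υ κ : Type} (P : LoopDesign k ι υ κ)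

/-- The state estimate formed from the outputs `y` in block `s`. -/
def blockReading (y : ℕ → κ → ℝ) (s : ℕ) : ι → ℝ := P.L fun j => y (s * P.T + j)

/-- The messages sent in block `s + 1` are the colour of the quantized reading of block `s`. -/
noncomputable def blockMessage (y : ℕ → κ → ℝ) (t : ℕ) : Message k :=
  P.col (quantize P.D (P.blockReading y (t / P.T - 1))) ⟨t % P.T, Nat.mod_lt t P.T_pos⟩

/-- The colours in a stream of messages. -/
def receivedColor (b : ℕ → Message k) (s : ℕ) : Fin P.T → Message k :=
  fun j => b ((s + 1) * P.T + j)

theorem receivedColor_eq (y : ℕ → κ → ℝ) (b : ℕ → Message k) (s : ℕ)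
    (hb : ∀ t, (s + 1) * P.T ≤ t → t < (s + 2) * P.T → b t = P.blockMessage y t) :
    P.receivedColor b s = P.col (quantize P.D (P.blockReading y s)) := by
  ext1 j
  have hj := j.2
  have hdiv : ((s + 1) * P.T + j) / P.T = s + 1 := by
    rw [mul_comm, Nat.mul_add_div P.T_pos, Nat.div_eq_of_lt hj, add_zero]
  have hmod : ((s + 1) * P.T + j) % P.T = j := by
    rw [mul_comm, Nat.mul_add_mod, Nat.mod_eq_of_lt hj]
  rw [receivedColor, hb _ (by omega) (by rw [show (s + 2) * P.T = (s + 1) * P.T + P.T by ring]; omega),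
    blockMessage]
  simp only [hdiv, hmod, Nat.add_sub_cancel]

/-- The observer that sends `blockMessage`, and an arbitrary message in the first block. -/
noncomputable def observer [Fintype ι] [Fintype κ] : CausalObserver k κ where
  message t y := P.blockMessage (fun s => if hs : s < t + 1 then y ⟨s, hs⟩ else 0) t
  measurable_message t := by
    have hread : Measurable fun y : Fin (t + 1) → κ → ℝ =>
        quantize P.D (P.blockReading (fun s => if hs : s < t + 1 then y ⟨s, hs⟩ else 0)
          (t / P.T - 1)) := by
      refine measurable_pi_iff.2 fun i => Int.measurable_floor.comp (Measurable.div_const ?_ _)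
      have hL : Measurable P.L := P.L.continuous_of_finiteDimensional.measurable
      refine (measurable_pi_apply i).comp (hL.comp (measurable_pi_iff.2 fun j => ?_))
      by_cases hs : (t / P.T - 1) * P.T + (j : ℕ) < t + 1
      · simp only [dif_pos hs]
        exact measurable_pi_apply _
      · simp only [dif_neg hs]
        exact measurable_const
    exact (measurable_of_countable
      (fun Q => P.col Q ⟨t % P.T, Nat.mod_lt t P.T_pos⟩)).comp hread

/-- From time T on, the reading in use belongs to a completed block, so the padding zeros of
`observer` play no role. -/
theorem observer_message [Fintype ι] [Fintype κ] (y : ℕ → κ → ℝ) (t : ℕ) (ht : P.T ≤ t) :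
    P.observer.message t (fun s : Fin (t + 1) => y s) = P.blockMessage y t := by
  have h1 : 1 ≤ t / P.T := (Nat.one_le_div_iff P.T_pos).2 ht
  have hle : (t / P.T - 1 + 1) * P.T ≤ t := by
    rw [Nat.sub_add_cancel h1]; exact Nat.div_mul_le_self t P.T
  rw [add_mul, one_mul] at hle
  change P.blockMessage _ t = _
  unfold blockMessage blockReading
  congr 5
  ext1 j
  have hj : (j : ℕ) < P.T := j.2.trans_le P.N_le
  exact dif_pos (by omega)

variable [Fintype ι] [DecidableEq ι] [Fintype υ]
variable (F : Matrix ι ι ℝ) (G : Matrix ι υ ℝ) (H : Matrix κ ι ℝ)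

/-- The contribution of the controls to the readings. -/
def controlReading (u : ℕ → υ → ℝ) : ℕ → ι → ℝ :=
  P.blockReading fun t => H *ᵥ controlResponse F G u t

/-- The controller's estimate of the uncontrolled state at the start of block `s`, from the messages
decoded at the end of block `s + 1`. -/
noncomputable def blockEstimate (dec : ℕ → ℕ → Message k) (u : ℕ → υ → ℝ) (s : ℕ) : ι → ℝ :=
  estimate (F ^ P.T) P.D P.col (P.controlReading F G H u)
    (P.receivedColor (dec ((s + 2) * P.T - 1))) (s + 1)

/-- The feedback law: no control in the first two blocks, then in each block the controls that would
bring the state to zero if the estimates were right. -/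
noncomputable def feedback (dec : ℕ → ℕ → Message k) (u : ℕ → υ → ℝ) (t : ℕ) : υ → ℝ :=
  if t < 2 * P.T then 0 else
    -- The estimate used in block s + 2 concerns time sT, and the target is time (s + 3)T: hence the
    -- cube.
    P.S (-(((F ^ P.T) ^ 3) *ᵥ P.blockEstimate F G H dec u (t / P.T - 2)) -
      (F ^ P.T) *ᵥ controlResponse F G u (t / P.T * P.T)) ⟨t % P.T, Nat.mod_lt t P.T_pos⟩

/-- Strict causality in the inputs: the controller can rebuild its own past inputs from the decoder
outputs, as a fixed point. -/
theorem feedback_congr (dec : ℕ → ℕ → Message k) (u u' : ℕ → υ → ℝ) (t : ℕ)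
    (h : ∀ s < t, u s = u' s) : P.feedback F G H dec u t = P.feedback F G H dec u' t := by
  unfold feedback
  split_ifs with ht
  · rfl
  have h2 : 2 ≤ t / P.T := (Nat.le_div_iff_mul_le P.T_pos).2 (not_lt.1 ht)
  have hle : t / P.T * P.T ≤ t := Nat.div_mul_le_self t P.T
  have hest : P.blockEstimate F G H dec u (t / P.T - 2) =
      P.blockEstimate F G H dec u' (t / P.T - 2) := by
    refine estimate_congr _ _ _ _ _ fun i hi => ?_
    refine congrArg P.L (funext fun j => ?_)
    have hj : (j : ℕ) < P.T := j.2.trans_le P.N_le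
    have hi' : (i + 1) * P.T ≤ t / P.T * P.T := Nat.mul_le_mul_right _ (by omega)
    rw [add_mul, one_mul] at hi'
    exact congrArg (H *ᵥ ·) (controlResponse_congr F G _ fun i' hi' => h i' (by omega))
  rw [hest, controlResponse_congr F G (u := u) (u' := u') _ fun i hi => h i (by omega)]

theorem feedback_congr_dec (dec dec' : ℕ → ℕ → Message k) (u : ℕ → υ → ℝ) (t : ℕ)
    (h : ∀ s < t, dec s = dec' s) : P.feedback F G H dec u t = P.feedback F G H dec' u t := by
  unfold feedback
  split_ifs with ht
  · rfl
  have h2 : 2 ≤ t / P.T := (Nat.le_div_iff_mul_le P.T_pos).2 (not_lt.1 ht)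
  have hle : t / P.T * P.T ≤ t := Nat.div_mul_le_self t P.T
  have hpos : 0 < t / P.T * P.T := Nat.mul_pos (by omega) P.T_pos
  unfold blockEstimate
  rw [Nat.sub_add_cancel h2, h _ (by omega)]

/-- The control sequence produced from the decoder outputs `dec`. -/
noncomputable def controls (dec : ℕ → ℕ → Message k) : ℕ → υ → ℝ :=
  causalFix (P.feedback F G H dec)

theorem controls_eq (dec : ℕ → ℕ → Message k) (t : ℕ) :
    P.controls F G H dec t = P.feedback F G H dec (P.controls F G H dec) t :=
  causalFix_eq (P.feedback_congr F G H dec) t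

theorem controls_congr (dec dec' : ℕ → ℕ → Message k) (t : ℕ) (h : ∀ s < t, dec s = dec' s) :
    P.controls F G H dec t = P.controls F G H dec' t :=
  causalFix_congr (P.feedback_congr F G H dec) t fun u s hs =>
    P.feedback_congr_dec F G H dec dec' u s fun i hi => h i (by omega)

/-- The controller that computes `controls` from what the decoder has put out. -/
noncomputable def controller : CausalController k υ where
  first := 0
  -- The default values for later decoder outputs do not matter, by `controls_congr`.
  next t z := P.controls F G H (fun s r =>
    if hs : s < t + 1 then if hr : r < s + 1 then z ⟨s, hs⟩ ⟨r, hr⟩ else default else default) (t + 1)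

end LoopDesign

/-! ### The closed loop along a path -/

/-- A path of the plant with bounded noises and initial state. -/
structure IsPlantPath {ι υ κ : Type*} [Fintype ι] [Fintype υ] [Fintype κ] (F : Matrix ι ι ℝ)
    (G : Matrix ι υ ℝ) (H : Matrix κ ι ℝ) (X₀ W V : ℝ) (w : ℕ → ι → ℝ) (v : ℕ → κ → ℝ)
    (x : ℕ → ι → ℝ) (y : ℕ → κ → ℝ) (u : ℕ → υ → ℝ) : Prop where
  init_bound : ‖x 0‖ ≤ X₀
  process_noise_bound : ∀ t, ‖w t‖ ≤ W
  measurement_noise_bound : ∀ t, ‖v t‖ ≤ V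
  state_eq : ∀ t, x (t + 1) = F *ᵥ x t + G *ᵥ u t + w t
  measurement_eq : ∀ t, y t = H *ᵥ x t + v t

theorem IsPlantPath.uncontrolled_succ {ι υ κ : Type*} [Fintype ι] [Fintype υ] [Fintype κ]
    {F : Matrix ι ι ℝ} {G : Matrix ι υ ℝ} {H : Matrix κ ι ℝ} {X₀ W V : ℝ} {w : ℕ → ι → ℝ}
    {v : ℕ → κ → ℝ} {x : ℕ → ι → ℝ} {y : ℕ → κ → ℝ} {u : ℕ → υ → ℝ}
    (h : IsPlantPath F G H X₀ W V w v x y u) (t : ℕ) :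
    x (t + 1) - controlResponse F G u (t + 1) =
      F *ᵥ (x t - controlResponse F G u t) + w t := by
  rw [h.state_eq, controlResponse, Matrix.mulVec_sub]
  abel

namespace LoopDesign

variable {k : ℕ} {ι υ κ : Type} [Fintype ι] [DecidableEq ι] [Fintype υ] [Fintype κ]

/-- The design suits the plant and the bounds on the initial state and on the noises. -/
structure IsAdequate (P : LoopDesign k ι υ κ) (F : Matrix ι ι ℝ) (G : Matrix ι υ ℝ)
    (H : Matrix κ ι ℝ) (X₀ W V : ℝ) : Prop where
  separates : Separates (F ^ P.T) P.col
  left_inverse : ∀ x : ι → ℝ, P.L (fun j => H *ᵥ ((F ^ (j : ℕ)) *ᵥ x)) = x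
  right_inverse : ∀ x : ι → ℝ,
    ∑ j : Fin P.T, (F ^ (P.T - 1 - (j : ℕ))) *ᵥ (G *ᵥ P.S x j) = x
  init_le : X₀ ≤ P.D
  noise_le : ∀ w : ℕ → ι → ℝ, (∀ t, ‖w t‖ ≤ W) → ∀ j ≤ P.T,
    ‖∑ i ∈ Finset.range j, (F ^ (j - 1 - i)) *ᵥ w i‖ ≤ P.D
  reading_le : ∀ (w : ℕ → ι → ℝ) (v : ℕ → κ → ℝ), (∀ t, ‖w t‖ ≤ W) → (∀ t, ‖v t‖ ≤ V) →
    ‖P.L fun j => H *ᵥ (∑ i ∈ Finset.range j, (F ^ ((j : ℕ) - 1 - i)) *ᵥ w i) + v j‖ ≤ P.D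

/-- Separation is stated in units of the cell, so D can be chosen after T and the colouring, large
enough to absorb the initial state and the noise accumulated over a block. -/
theorem exists_isAdequate (F : Matrix ι ι ℝ) (G : Matrix ι υ ℝ) (H : Matrix κ ι ℝ)
    (X₀ W V : ℝ) {c r : ℝ} (hc : 0 ≤ c) (hr : 1 ≤ r)
    (hF : ∀ (d : ℕ) (x : ι → ℝ), ‖(F ^ d) *ᵥ x‖ ≤ c * r ^ d * ‖x‖) {N T : ℕ} (hT : 0 < T)
    (hNT : N ≤ T) (L : (Fin N → κ → ℝ) →ₗ[ℝ] (ι → ℝ))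
    (hL : ∀ x : ι → ℝ, L (fun j => H *ᵥ ((F ^ (j : ℕ)) *ᵥ x)) = x)
    (S : (ι → ℝ) →ₗ[ℝ] (Fin T → υ → ℝ))
    (hS : ∀ x : ι → ℝ, ∑ j : Fin T, (F ^ (T - 1 - (j : ℕ))) *ᵥ (G *ᵥ S x j) = x)
    (col : (ι → ℤ) → Fin T → Message k) (hcol : Separates (F ^ T) col) :
    ∃ P : LoopDesign k ι υ κ, P.IsAdequate F G H X₀ W V := by
  obtain ⟨cL, hcL, hLn⟩ := L.exists_norm_bound
  obtain ⟨cH, hcH, hHn⟩ := H.mulVecLin.exists_norm_bound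
  set B := T * (c * r ^ T * |W|)
  have hB : 0 ≤ B := by positivity
  have hnoise : ∀ w : ℕ → ι → ℝ, (∀ t, ‖w t‖ ≤ W) → ∀ j ≤ T,
      ‖∑ i ∈ Finset.range j, (F ^ (j - 1 - i)) *ᵥ w i‖ ≤ B := by
    intro w hw j hj
    refine (norm_sum_le_of_le _ (fun i _ => ?_) :
      _ ≤ ∑ _i ∈ Finset.range j, c * r ^ T * |W|).trans ?_
    · refine (hF _ _).trans (mul_le_mul ?_ ((hw i).trans (le_abs_self _)) (norm_nonneg _)
        (by positivity))
      exact mul_le_mul_of_nonneg_left (pow_le_pow_right₀ hr (by omega)) hc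
    · rw [Finset.sum_const, Finset.card_range, nsmul_eq_mul]
      exact mul_le_mul_of_nonneg_right (Nat.cast_le.2 hj) (by positivity)
  set D := 1 + |X₀| + B + cL * (cH * B + |V|)
  have hrest : 0 ≤ cL * (cH * B + |V|) := by positivity
  refine ⟨⟨N, T, hT, hNT, D, by positivity, col, L, S⟩, hcol, hL, hS, ?_, ?_, ?_⟩
  · simp only [D]
    linarith [le_abs_self X₀]
  · intro w hw j hj
    refine (hnoise w hw j hj).trans ?_
    simp only [D]
    linarith [abs_nonneg X₀]
  · intro w v hw hv
    refine (hLn _).trans ((mul_le_mul_of_nonneg_left ((pi_norm_le_iff_of_nonneg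
      (by positivity : 0 ≤ cH * B + |V|)).2 fun j => ?_) hcL).trans ?_)
    · refine (norm_add_le _ _).trans (add_le_add ((hHn _).trans ?_)
        ((hv _).trans (le_abs_self _)))
      exact mul_le_mul_of_nonneg_left (hnoise w hw j (j.2.le.trans hNT)) hcH
    · simp only [D]
      linarith [abs_nonneg X₀]

variable {P : LoopDesign k ι υ κ} {F : Matrix ι ι ℝ} {G : Matrix ι υ ℝ} {H : Matrix κ ι ℝ}
  {X₀ W V : ℝ}

namespace IsAdequate

variable (hP : P.IsAdequate F G H X₀ W V)
include hP

theorem norm_uncontrolled_sub_le {w : ℕ → ι → ℝ} {v : ℕ → κ → ℝ} {x : ℕ → ι → ℝ} {y : ℕ → κ → ℝ}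
    {u : ℕ → υ → ℝ} (h : IsPlantPath F G H X₀ W V w v x y u) (s : ℕ) :
    ‖(x ((s + 1) * P.T) - controlResponse F G u ((s + 1) * P.T)) -
      (F ^ P.T) *ᵥ (x (s * P.T) - controlResponse F G u (s * P.T))‖ ≤ P.D := by
  have := affine_iterate F (fun t => x t - controlResponse F G u t) w h.uncontrolled_succ
    (s * P.T) P.T
  rw [← Nat.succ_mul] at this
  rw [this, add_sub_cancel_left]
  exact hP.noise_le (fun i => w (s * P.T + i)) (fun t => h.process_noise_bound _) P.T le_rfl

theorem norm_reading_sub_le {w : ℕ → ι → ℝ} {v : ℕ → κ → ℝ} {x : ℕ → ι → ℝ} {y : ℕ → κ → ℝ}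
    {u : ℕ → υ → ℝ} (h : IsPlantPath F G H X₀ W V w v x y u) (s : ℕ) :
    ‖P.blockReading y s - P.controlReading F G H u s -
      (x (s * P.T) - controlResponse F G u (s * P.T))‖ ≤ P.D := by
  have key : P.blockReading y s - P.controlReading F G H u s -
      (x (s * P.T) - controlResponse F G u (s * P.T)) =
      P.L fun j => H *ᵥ (∑ i ∈ Finset.range j, (F ^ ((j : ℕ) - 1 - i)) *ᵥ w (s * P.T + i)) +
        v (s * P.T + j) := by
    conv_lhs => rw [← hP.left_inverse (x (s * P.T) - controlResponse F G u (s * P.T))]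
    rw [blockReading, controlReading, blockReading, ← map_sub, ← map_sub]
    congr 1
    ext1 j
    have := affine_iterate F (fun t => x t - controlResponse F G u t) w h.uncontrolled_succ
      (s * P.T) j
    simp only [Pi.sub_apply, h.measurement_eq]
    rw [eq_sub_of_add_eq' this.symm]
    simp only [Matrix.mulVec_sub]
    abel
  rw [key]
  exact hP.reading_le (fun i => w (s * P.T + i)) (fun i => v (s * P.T + i))
    (fun t => h.process_noise_bound _) fun t => h.measurement_noise_bound _

theorem exists_prediction_error_bound {c r : ℝ} (hc : 0 ≤ c) (hr : 1 < r)
    (hF : ∀ (d : ℕ) (x : ι → ℝ), ‖(F ^ d) *ᵥ x‖ ≤ c * r ^ d * ‖x‖) :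
    ∃ K : ℝ, 0 ≤ K ∧ ∀ (w : ℕ → ι → ℝ) (v : ℕ → κ → ℝ) (x : ℕ → ι → ℝ) (y : ℕ → κ → ℝ)
      (u : ℕ → υ → ℝ) (dec : ℕ → ℕ → Message k) (b : ℕ → Message k),
      IsPlantPath F G H X₀ W V w v x y u → (∀ t, P.T ≤ t → b t = P.blockMessage y t) →
      ∀ s δ : ℕ, (∀ τ, τ + δ < (s + 2) * P.T → dec ((s + 2) * P.T - 1) τ = b τ) →
        ‖(x ((s + 1) * P.T) - controlResponse F G u ((s + 1) * P.T)) -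
          (F ^ P.T) *ᵥ P.blockEstimate F G H dec u s‖ ≤ K * r ^ δ := by
  have hTpos := P.T_pos
  obtain ⟨K, hK, hbound⟩ := exists_estimate_error_bound P.D_pos hP.separates hc
    (one_lt_pow₀ hr hTpos.ne') (A := F ^ P.T) (ρ := r ^ P.T)
    (fun d x => by rw [← pow_mul, ← pow_mul]; exact hF _ x)
  refine ⟨K * r ^ P.T, by positivity, fun w v x y u dec b h hb s δ hδ => ?_⟩
  -- The number of blocks that a delay of δ steps can spoil: δ / T rounded up, capped by the s + 1
  -- blocks received. Rounding costs the factor r^T in the constant.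
  set d := min (s + 1) ((δ + P.T - 1) / P.T) with hd
  have hdT : P.T * d ≤ δ + P.T := by
    have h1 : P.T * d ≤ P.T * ((δ + P.T - 1) / P.T) := Nat.mul_le_mul_left _ (min_le_right _ _)
    have h2 := Nat.mul_div_le (δ + P.T - 1) P.T
    omega
  have := hbound (P.controlReading F G H u) (P.blockReading y)
    (fun s => x (s * P.T) - controlResponse F G u (s * P.T))
    (P.receivedColor (dec ((s + 2) * P.T - 1)))
    (by simpa [controlResponse] using h.init_bound.trans hP.init_le)
    (hP.norm_uncontrolled_sub_le h) (hP.norm_reading_sub_le h) (s + 1 - d) d (by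
      intro i hi
      refine P.receivedColor_eq y _ i fun t ht1 ht2 => ?_
      have hTt : P.T ≤ t := (Nat.le_mul_of_pos_left _ (by omega)).trans ht1
      rw [← hb t hTt]
      refine hδ t ?_
      have hdlt : (δ + P.T - 1) / P.T = d := by
        rcases le_total (s + 1) ((δ + P.T - 1) / P.T) with h' | h'
        · rw [min_eq_left h'] at hd; omega
        · rw [hd, min_eq_right h']
      have hδd : δ ≤ P.T * d := by
        have := Nat.div_add_mod (δ + P.T - 1) P.T
        have := Nat.mod_lt (δ + P.T - 1) hTpos
        rw [hdlt] at *
        omega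
      have hid : (i + 2 + d) * P.T ≤ (s + 2) * P.T := Nat.mul_le_mul_right _ (by omega)
      rw [add_mul, mul_comm d] at hid
      omega)
  rw [Nat.sub_add_cancel (min_le_left _ _)] at this
  refine this.trans ?_
  rw [← pow_mul, mul_assoc, ← pow_add]
  exact mul_le_mul_of_nonneg_left (pow_le_pow_right₀ hr.le (by omega)) hK

/-- By the choice of inputs, the control response cancels the extrapolated estimate at the end of
each block. -/
theorem controlResponse_block {dec : ℕ → ℕ → Message k} {u : ℕ → υ → ℝ}
    (hu : ∀ t, u t = P.feedback F G H dec u t) (s : ℕ) :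
    controlResponse F G u ((s + 3) * P.T) =
      -(((F ^ P.T) ^ 3) *ᵥ P.blockEstimate F G H dec u s) := by
  have h := affine_iterate F (controlResponse F G u) (fun t => G *ᵥ u t) (fun t => rfl)
    ((s + 2) * P.T) P.T
  rw [← Nat.succ_mul] at h
  have hsum := hP.right_inverse (-(((F ^ P.T) ^ 3) *ᵥ P.blockEstimate F G H dec u s) -
      (F ^ P.T) *ᵥ controlResponse F G u ((s + 2) * P.T))
  rw [show s + 3 = (s + 2).succ from rfl, h, Finset.sum_range]
  rw [eq_sub_iff_add_eq'] at hsum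
  rw [← hsum]
  congr 1
  refine Finset.sum_congr rfl fun j _ => ?_
  have hj := j.2
  have hdiv : ((s + 2) * P.T + j) / P.T = s + 2 := by
    rw [mul_comm, Nat.mul_add_div P.T_pos, Nat.div_eq_of_lt hj, add_zero]
  have hmod : ((s + 2) * P.T + j) % P.T = j := by
    rw [mul_comm, Nat.mul_add_mod, Nat.mod_eq_of_lt hj]
  rw [hu, feedback, if_neg (by nlinarith)]
  simp only [hdiv, hmod, Nat.add_sub_cancel]

/-- At a block boundary the state is the prediction error from two blocks earlier, propagated, plus
noise. Within the block the steering target is a combination of the old and the new prediction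
errors and noise, so the inputs stay of the same order; two consecutive delays δ and δ' enter. -/
theorem exists_state_bound {c r : ℝ} (hc : 0 ≤ c) (hr : 1 < r)
    (hF : ∀ (d : ℕ) (x : ι → ℝ), ‖(F ^ d) *ᵥ x‖ ≤ c * r ^ d * ‖x‖) :
    ∃ K : ℝ, 0 ≤ K ∧ ∀ (w : ℕ → ι → ℝ) (v : ℕ → κ → ℝ) (x : ℕ → ι → ℝ) (y : ℕ → κ → ℝ)
      (u : ℕ → υ → ℝ) (dec : ℕ → ℕ → Message k) (b : ℕ → Message k),
      IsPlantPath F G H X₀ W V w v x y u → (∀ t, P.T ≤ t → b t = P.blockMessage y t) →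
      (∀ t, u t = P.feedback F G H dec u t) →
      ∀ s j δ δ' : ℕ, j < P.T →
        (∀ τ, τ + δ < (s + 2) * P.T → dec ((s + 2) * P.T - 1) τ = b τ) →
        (∀ τ, τ + δ' < (s + 3) * P.T → dec ((s + 3) * P.T - 1) τ = b τ) →
        ‖x ((s + 3) * P.T + j)‖ ≤ K * (1 + r ^ δ + r ^ δ') := by
  obtain ⟨K₁, hK₁, herr⟩ := hP.exists_prediction_error_bound hc hr hF
  obtain ⟨cG, hcG, hG⟩ := G.mulVecLin.exists_norm_bound
  obtain ⟨cS, hcS, hS⟩ := P.S.exists_norm_bound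
  have hr0 : 0 < r := by linarith
  have hD := P.D_pos
  set m := c * r ^ P.T
  have hm : 0 ≤ m := by positivity
  have hFj : ∀ j ≤ P.T, ∀ x, ‖(F ^ j) *ᵥ x‖ ≤ m * ‖x‖ := fun j hj x => (hF j x).trans
    (mul_le_mul_of_nonneg_right
      (mul_le_mul_of_nonneg_left (pow_le_pow_right₀ hr.le hj) hc) (norm_nonneg _))
  set A := F ^ P.T
  have hA : ∀ x, ‖A *ᵥ x‖ ≤ m * ‖x‖ := hFj _ le_rfl
  have hAle : ∀ (x : ι → ℝ) (B : ℝ), ‖x‖ ≤ B → ‖A *ᵥ x‖ ≤ m * B := fun x B h =>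
    (hA x).trans (mul_le_mul_of_nonneg_left h hm)
  have hA3 : ∀ x, (A ^ 3) *ᵥ x = A *ᵥ (A *ᵥ (A *ᵥ x)) := fun x => by
    rw [Matrix.mulVec_mulVec, Matrix.mulVec_mulVec, pow_three']
  set Q := (m ^ 3 + m ^ 2 + m + 1) * (K₁ + P.D)
  have hQ : 0 ≤ Q := by positivity
  refine ⟨m * Q + P.T * (m * (cG * cS * Q + |W|)), by positivity,
    fun w v x y u dec b h hb hu s j δ δ' hj hδ hδ' => ?_⟩
  have ha := one_le_pow₀ hr.le (n := δ)
  have hb' := one_le_pow₀ hr.le (n := δ')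
  have he := herr w v x y u dec b h hb s δ hδ
  have he' := herr w v x y u dec b h hb (s + 1) δ' hδ'
  set p := r ^ δ
  set p' := r ^ δ'
  have hN1 := hP.norm_uncontrolled_sub_le h (s + 1)
  have hN2 := hP.norm_uncontrolled_sub_le h (s + 2)
  have hxc := hP.controlResponse_block hu s
  simp only [add_assoc, Nat.reduceAdd] at he' hN1 hN2
  set x₁ := x ((s + 1) * P.T) - controlResponse F G u ((s + 1) * P.T)
  set x₂ := x ((s + 2) * P.T) - controlResponse F G u ((s + 2) * P.T)
  set x₃ := x ((s + 3) * P.T) - controlResponse F G u ((s + 3) * P.T) with hx₃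
  set E := P.blockEstimate F G H dec u s
  set E' := P.blockEstimate F G H dec u (s + 1)
  have hstart : x ((s + 3) * P.T) = A *ᵥ (A *ᵥ (x₁ - A *ᵥ E)) + A *ᵥ (x₂ - A *ᵥ x₁) +
      (x₃ - A *ᵥ x₂) := by
    rw [eq_add_of_sub_eq hx₃.symm, hxc, hA3]
    simp only [Matrix.mulVec_sub]
    abel
  have harg : -((A ^ 3) *ᵥ E') - A *ᵥ controlResponse F G u ((s + 3) * P.T) =
      A *ᵥ (A *ᵥ (x₂ - A *ᵥ E')) - A *ᵥ (A *ᵥ (A *ᵥ (x₁ - A *ᵥ E))) -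
        A *ᵥ (A *ᵥ (x₂ - A *ᵥ x₁)) := by
    rw [hxc, hA3, hA3]
    simp only [Matrix.mulVec_sub, Matrix.mulVec_neg]
    abel
  have hstart_le : ‖x ((s + 3) * P.T)‖ ≤ Q * (1 + p + p') := by
    rw [hstart]
    refine norm_add₃_le.trans ((add_le_add (add_le_add (hAle _ _ (hAle _ _ he))
      (hAle _ _ hN1)) hN2).trans ?_)
    -- The slack is written as a sum of visibly nonnegative terms.
    have e : Q * (1 + p + p') - (m * (m * (K₁ * p)) + m * P.D + P.D) =
      (m ^ 3 + m + 1) * K₁ * (1 + p + p') + m ^ 2 * K₁ * (1 + p') +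
      (m ^ 3 + m ^ 2) * P.D * (1 + p + p') + (m + 1) * P.D * (p + p') := by simp only [Q]; ring
    have : 0 ≤ Q * (1 + p + p') - (m * (m * (K₁ * p)) + m * P.D + P.D) := by
      rw [e]; positivity
    linarith
  set g := -((A ^ 3) *ᵥ E') - A *ᵥ controlResponse F G u ((s + 3) * P.T) with hg
  have hg_le : ‖g‖ ≤ Q * (1 + p + p') := by
    rw [harg]
    refine (norm_sub_le _ _).trans ((add_le_add ((norm_sub_le _ _).trans (add_le_add
      (hAle _ _ (hAle _ _ he')) (hAle _ _ (hAle _ _ (hAle _ _ he)))))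
      (hAle _ _ (hAle _ _ hN1))).trans ?_)
    have e : Q * (1 + p + p') - (m * (m * (K₁ * p')) + m * (m * (m * (K₁ * p))) + m * (m * P.D)) =
      (m + 1) * K₁ * (1 + p + p') + m ^ 2 * K₁ * (1 + p) + m ^ 3 * K₁ * (1 + p') +
      (m ^ 3 + m + 1) * P.D * (1 + p + p') + m ^ 2 * P.D * (p + p') := by simp only [Q]; ring
    have : 0 ≤ Q * (1 + p + p') -
        (m * (m * (K₁ * p')) + m * (m * (m * (K₁ * p))) + m * (m * P.D)) := by
      rw [e]; positivity
    linarith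
  have hinput : ∀ i < P.T, ‖G *ᵥ u ((s + 3) * P.T + i) + w ((s + 3) * P.T + i)‖ ≤
      (cG * cS * Q + |W|) * (1 + p + p') := by
    intro i hi
    have hdiv : ((s + 3) * P.T + i) / P.T = s + 3 := by
      rw [mul_comm, Nat.mul_add_div P.T_pos, Nat.div_eq_of_lt hi, add_zero]
    have hmod : ((s + 3) * P.T + i) % P.T = i := by
      rw [mul_comm, Nat.mul_add_mod, Nat.mod_eq_of_lt hi]
    have hui : u ((s + 3) * P.T + i) = P.S g ⟨i, hi⟩ := by
      rw [hu, feedback, if_neg (by nlinarith)]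
      simp only [hdiv, hmod]
      rfl
    rw [hui]
    have h1 : ‖G *ᵥ P.S g ⟨i, hi⟩‖ ≤ cG * (cS * (Q * (1 + p + p'))) :=
      (hG _).trans (mul_le_mul_of_nonneg_left (((norm_le_pi_norm _ _).trans (hS g)).trans
        (mul_le_mul_of_nonneg_left hg_le hcS)) hcG)
    have h2 : ‖w ((s + 3) * P.T + i)‖ ≤ |W| := (h.process_noise_bound _).trans (le_abs_self W)
    have h3 : |W| ≤ |W| * (1 + p + p') := le_mul_of_one_le_right (abs_nonneg W) (by linarith)
    refine (norm_add_le _ _).trans ((add_le_add h1 (h2.trans h3)).trans_eq (by ring))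
  rw [affine_iterate F x (fun t => G *ᵥ u t + w t) (fun t => by rw [h.state_eq, add_assoc]),
    add_mul (m * Q)]
  refine (norm_add_le _ _).trans (add_le_add ?_ ?_)
  · rw [mul_assoc]
    exact (hFj j hj.le _).trans (mul_le_mul_of_nonneg_left hstart_le hm)
  · refine (norm_sum_le_of_le _ (fun i hi => ?_) :
      _ ≤ ∑ _i ∈ Finset.range j, m * ((cG * cS * Q + |W|) * (1 + p + p'))).trans ?_
    · have hi := Finset.mem_range.1 hi
      exact (hFj _ (by omega) _).trans (mul_le_mul_of_nonneg_left (hinput i (by omega)) hm)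
    · rw [Finset.sum_const, Finset.card_range, nsmul_eq_mul, mul_assoc (P.T : ℝ), mul_assoc m]
      exact mul_le_mul_of_nonneg_right (Nat.cast_le.2 hj.le) (by positivity)

end IsAdequate
end LoopDesign

/-! ### Moments of the decoding delay -/

open scoped Classical in
/-- The delay of the earliest decoding error at time `t`, or `0` if there is none. -/
noncomputable def decodingDelay {k n : ℕ} {Z : Type v} [MeasurableSpace Z] (code : CausalCode k n Z)
    {Ω : Type u} (b : ℕ → Ω → Message k) (z : ℕ → Ω → Fin n → Z) (t : ℕ) (ω : Ω) : ℕ :=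
  if (decodingErrors code b z t ω).Nonempty then t + 1 - sInf (decodingErrors code b z t ω) else 0

section DecodingDelay

variable {k n : ℕ} {Z : Type v} [MeasurableSpace Z] (code : CausalCode k n Z)
  {Ω : Type u} (b : ℕ → Ω → Message k) (z : ℕ → Ω → Fin n → Z) (t : ℕ) (ω : Ω)

theorem decode_eq_of_add_decodingDelay_lt {τ : ℕ}
    (h : τ + decodingDelay code b z t ω < t + 1) :
    code.decode t (fun s : Fin (t + 1) => z s ω) ⟨τ, by omega⟩ = b τ ω := by
  by_contra hne
  have hmem : τ ∈ decodingErrors code b z t ω := ⟨by omega, hne⟩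
  have hle := Nat.sInf_le hmem
  rw [decodingDelay, if_pos ⟨τ, hmem⟩] at h
  omega

theorem exists_isLeast_of_decodingDelay_pos (h : 0 < decodingDelay code b z t ω) :
    ∃ τ : ℕ, IsLeast (decodingErrors code b z t ω) τ ∧
      τ + decodingDelay code b z t ω = t + 1 := by
  have hne : (decodingErrors code b z t ω).Nonempty := by
    by_contra hne
    rw [decodingDelay, if_neg hne] at h
    exact lt_irrefl _ h
  have hmem := Nat.sInf_mem hne
  refine ⟨sInf (decodingErrors code b z t ω), ⟨hmem, fun τ hτ => Nat.sInf_le hτ⟩, ?_⟩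
  obtain ⟨hlt, -⟩ := hmem
  rw [decodingDelay, if_pos hne]
  omega

end DecodingDelay

theorem IsAnytimeCode.exists_moment_bound {k n : ℕ} {Z : Type v} [MeasurableSpace Z]
    {ch : CausalChannel n Z} {code : CausalCode k n Z} {R β : ℝ}
    (hcode : IsAnytimeCode.{u, v} ch code R β) {r : ℝ} (hr : 1 < r)
    (hrβ : r ^ 2 * (2 : ℝ) ^ (-((n : ℝ) * β)) < 1)
    {Ω : Type u} [MeasurableSpace Ω] (μ : Measure Ω) [IsProbabilityMeasure μ]
    (b : ℕ → Ω → Message k) (z : ℕ → Ω → Fin n → Z) (h : IsTransmission ch code μ b z) :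
    ∃ M : ENNReal, M < ⊤ ∧ ∀ t, ∃ φ : Ω → ENNReal, Measurable φ ∧
      (∀ ω, ENNReal.ofReal ((r ^ decodingDelay code b z t ω) ^ 2) ≤ φ ω) ∧ ∫⁻ ω, φ ω ∂μ ≤ M := by
  obtain ⟨d₀, -, -, η, hη⟩ := hcode
  set q := r ^ 2 * (2 : ℝ) ^ (-((n : ℝ) * β)) with hq
  have hr0 : 0 < r := by linarith
  have hq0 : 0 < q := by positivity
  -- The first term serves d ≥ d₀, where reliability applies; the second covers d < d₀ with the
  -- trivial bound 1 on probabilities.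
  set K := |η| + (r ^ d₀) ^ 2 / q ^ d₀
  have hK : 0 ≤ K := by positivity
  have hsum : Summable fun d : ℕ => K * q ^ d :=
    (summable_geometric_of_lt_one hq0.le hrβ).mul_left K
  refine ⟨1 + ENNReal.ofReal (∑' d, K * q ^ d), by simp [ENNReal.add_lt_top], fun t => ?_⟩
  -- Measurable hulls have the same measure, so no measurability of the error events has to be
  -- shown.
  let E : ℕ → Set Ω := fun d => toMeasurable μ
    {ω | ∃ τ : ℕ, IsLeast (decodingErrors code b z t ω) τ ∧ τ + d = t + 1}
  have hE : ∀ d, MeasurableSet (E d) := fun d => measurableSet_toMeasurable _ _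
  have hmeas : ∀ d, Measurable ((E d).indicator fun _ => ENNReal.ofReal ((r ^ d) ^ 2)) :=
    fun d => measurable_const.indicator (hE d)
  refine ⟨fun ω => 1 + ∑' d, (E d).indicator (fun _ => ENNReal.ofReal ((r ^ d) ^ 2)) ω,
    measurable_const.add (Measurable.tsum hmeas), fun ω => ?_, ?_⟩
  · rcases Nat.eq_zero_or_pos (decodingDelay code b z t ω) with h0 | hpos
    · simp [h0]
    · have hmem : ω ∈ E (decodingDelay code b z t ω) := subset_toMeasurable _ _
        (exists_isLeast_of_decodingDelay_pos code b z t ω hpos)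
      refine le_trans ?_ le_add_self
      refine le_trans ?_ (ENNReal.le_tsum (decodingDelay code b z t ω))
      rw [Set.indicator_of_mem hmem]
  · rw [lintegral_add_left measurable_const, lintegral_const, measure_univ, mul_one,
      lintegral_tsum fun d => (hmeas d).aemeasurable,
      ENNReal.ofReal_tsum_of_nonneg (fun d => by positivity) hsum]
    gcongr with d
    rw [lintegral_indicator_const (hE d), measure_toMeasurable]
    rcases lt_or_ge d d₀ with hd | hd
    · refine (mul_le_of_le_one_right' prob_le_one).trans (ENNReal.ofReal_le_ofReal ?_)
      have h1 : (r ^ d) ^ 2 ≤ (r ^ d₀) ^ 2 :=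
        pow_le_pow_left₀ (by positivity) (pow_le_pow_right₀ hr.le hd.le) 2
      have h2 : (r ^ d₀) ^ 2 / q ^ d₀ * q ^ d₀ ≤ (r ^ d₀) ^ 2 / q ^ d₀ * q ^ d :=
        mul_le_mul_of_nonneg_left (pow_le_pow_of_le_one hq0.le hrβ.le hd.le) (by positivity)
      rw [div_mul_cancel₀ _ (pow_pos hq0 _).ne'] at h2
      have h3 : 0 ≤ |η| * q ^ d := by positivity
      rw [add_mul]
      linarith
    · refine (mul_le_mul_right (hη Ω μ b z h t d hd) _).trans ?_
      rw [← ENNReal.ofReal_mul (by positivity)]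
      refine ENNReal.ofReal_le_ofReal ?_
      have hpow : (r ^ d) ^ 2 * (2 : ℝ) ^ (-((n : ℝ) * β * (d : ℝ))) = q ^ d := by
        rw [hq, mul_pow, ← Real.rpow_mul_natCast zero_le_two, neg_mul, pow_right_comm]
      calc (r ^ d) ^ 2 * (η * (2 : ℝ) ^ (-((n : ℝ) * β * (d : ℝ)))) = η * q ^ d := by
            rw [← hpow]; ring
        _ ≤ K * q ^ d := by
            refine mul_le_mul_of_nonneg_right ?_ (pow_pos hq0 d).le
            have : 0 ≤ (r ^ d₀) ^ 2 / q ^ d₀ := by positivity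
            simp only [K]
            linarith [le_abs_self η]

/-! ### Stability of the closed loop -/

theorem LoopDesign.IsAdequate.isMeanSquareStable {k n : ℕ} {ι υ κ : Type} [Fintype ι]
    [DecidableEq ι] [Fintype υ] [Fintype κ] {P : LoopDesign k ι υ κ} {F : Matrix ι ι ℝ}
    {G : Matrix ι υ ℝ} {H : Matrix κ ι ℝ} {X₀ W V : ℝ} (hP : P.IsAdequate F G H X₀ W V)
    {c r : ℝ} (hc : 0 ≤ c) (hr : 1 < r)
    (hF : ∀ (d : ℕ) (x : ι → ℝ), ‖(F ^ d) *ᵥ x‖ ≤ c * r ^ d * ‖x‖)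
    {Z : Type v} [MeasurableSpace Z] {ch : CausalChannel n Z} {code : CausalCode k n Z} {R β : ℝ}
    (hcode : IsAnytimeCode.{u, v} ch code R β)
    (hrβ : r ^ 2 * (2 : ℝ) ^ (-((n : ℝ) * β)) < 1)
    {Ω : Type u} [MeasurableSpace Ω] {μ : Measure Ω} [IsProbabilityMeasure μ]
    {w : ℕ → Ω → ι → ℝ} {v : ℕ → Ω → κ → ℝ} {x : ℕ → Ω → ι → ℝ} {y : ℕ → Ω → κ → ℝ}
    {u : ℕ → Ω → υ → ℝ} {b : ℕ → Ω → Message k} {z : ℕ → Ω → Fin n → Z}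
    (h : IsClosedLoop F G H X₀ W V P.observer (P.controller F G H) ch code μ w v x y u b z) :
    IsMeanSquareStable μ x := by
  obtain ⟨K, hK, hstate⟩ := hP.exists_state_bound hc hr hF
  obtain ⟨M, hM, hmoment⟩ := hcode.exists_moment_bound hr hrβ μ b z h.transmission
  choose φ hφm hφle hφint using hmoment
  have hT := P.T_pos
  set B := (Fintype.card ι : ℝ) * (3 * K ^ 2)
  have hB : 0 ≤ B := by positivity
  let dec : Ω → ℕ → ℕ → Message k := fun ω s τ =>
    if hτ : τ < s + 1 then code.decode s (fun i : Fin (s + 1) => z i ω) ⟨τ, hτ⟩ else default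
  have hu : ∀ ω t, u t ω = P.controls F G H (dec ω) t := by
    intro ω t
    cases t with
    | zero =>
      rw [h.first_input_eq, P.controls_eq, LoopDesign.feedback, if_pos (by omega)]
      rfl
    | succ t =>
      rw [h.next_input_eq]
      refine P.controls_congr F G H _ _ _ fun s hs => ?_
      ext1 τ
      simp only [dif_pos hs, dec]
  have hpath : ∀ᵐ ω ∂μ, IsPlantPath F G H X₀ W V (fun t => w t ω) (fun t => v t ω)
      (fun t => x t ω) (fun t => y t ω) fun t => u t ω := by
    filter_upwards [h.init_bound, ae_all_iff.2 h.process_noise_bound,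
      ae_all_iff.2 h.measurement_noise_bound] with ω h0 hw hv
    exact ⟨h0, fun t => by linarith [hw t, norm_nonneg (w t ω)],
      fun t => by linarith [hv t, norm_nonneg (v t ω)], fun t => h.state_eq t ω,
      fun t => h.measurement_eq t ω⟩
  have hdec : ∀ ω s τ, τ + decodingDelay code b z ((s + 2) * P.T - 1) ω < (s + 2) * P.T →
      dec ω ((s + 2) * P.T - 1) τ = b τ ω := by
    intro ω s τ hτ
    rw [← decode_eq_of_add_decodingDelay_lt code b z ((s + 2) * P.T - 1) ω (τ := τ) (by omega)]
    exact dif_pos (by omega)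
  have hbound : ∀ t, 3 * P.T ≤ t →
      ∫⁻ ω, ENNReal.ofReal (∑ i, x t ω i ^ 2) ∂μ ≤ ENNReal.ofReal B * (1 + M + M) := by
    intro t ht
    obtain ⟨s, hs⟩ := Nat.exists_eq_add_of_le ((Nat.le_div_iff_mul_le hT).2 ht)
    have hts : (s + 3) * P.T + t % P.T = t := by
      rw [add_comm s, ← hs, mul_comm]
      exact Nat.div_add_mod t P.T
    set t₁ := (s + 2) * P.T - 1
    set t₂ := (s + 3) * P.T - 1
    calc ∫⁻ ω, ENNReal.ofReal (∑ i, x t ω i ^ 2) ∂μ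
        ≤ ∫⁻ ω, ENNReal.ofReal B * (1 + φ t₁ ω + φ t₂ ω) ∂μ := by
          refine lintegral_mono_ae ?_
          filter_upwards [hpath] with ω hω
          set p := r ^ decodingDelay code b z t₁ ω
          set p' := r ^ decodingDelay code b z t₂ ω
          have hx : ‖x t ω‖ ≤ K * (1 + p + p') := by
            have := hstate _ _ _ _ _ (dec ω) (fun t => b t ω) hω
              (fun t ht => by rw [h.message_eq, P.observer_message (fun t => y t ω) t ht])
              (fun t => by
                rw [hu, P.controls_eq]
                exact congrArg (fun f => P.feedback F G H (dec ω) f t)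
                  (funext fun t => (hu ω t).symm))
              s (t % P.T) _ _ (Nat.mod_lt t hT) (hdec ω s) (hdec ω (s + 1))
            rwa [hts] at this
          have hsq : ∑ i, x t ω i ^ 2 ≤ B * (1 + p ^ 2 + p' ^ 2) := by
            have h1 : ∀ i, x t ω i ^ 2 ≤ 3 * K ^ 2 * (1 + p ^ 2 + p' ^ 2) := by
              intro i
              have h2 : |x t ω i| ≤ K * (1 + p + p') := (norm_le_pi_norm (x t ω) i).trans hx
              have h3 : x t ω i ^ 2 ≤ (K * (1 + p + p')) ^ 2 :=
                sq_le_sq' (abs_le.1 h2).1 (abs_le.1 h2).2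
              have h4 : (1 + p + p') ^ 2 ≤ 3 * (1 + p ^ 2 + p' ^ 2) := by
                -- The 3 in B is this Cauchy-Schwarz constant; the factor `Fintype.card ι` passes
                -- from the sup norm to the Euclidean norm.
                nlinarith [sq_nonneg (p - 1), sq_nonneg (p' - 1), sq_nonneg (p - p')]
              have h5 := mul_le_mul_of_nonneg_left h4 (sq_nonneg K)
              linarith [mul_pow K (1 + p + p') 2]
            refine (Finset.sum_le_sum fun i _ => h1 i).trans_eq ?_
            rw [Finset.sum_const, Finset.card_univ, nsmul_eq_mul, ← mul_assoc]
          refine (ENNReal.ofReal_le_ofReal hsq).trans ?_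
          rw [ENNReal.ofReal_mul hB, ENNReal.ofReal_add (by positivity) (by positivity),
            ENNReal.ofReal_add zero_le_one (by positivity), ENNReal.ofReal_one]
          gcongr
          · exact hφle t₁ ω
          · exact hφle t₂ ω
      _ ≤ ENNReal.ofReal B * (1 + M + M) := by
          rw [lintegral_const_mul' _ _ ENNReal.ofReal_ne_top,
            lintegral_add_right _ (hφm t₂), lintegral_add_right _ (hφm t₁), lintegral_const,
            measure_univ, mul_one]
          gcongr
          · exact hφint t₁
          · exact hφint t₂
  refine (limsup_le_of_le (h := ?_)).trans_lt (b := ENNReal.ofReal B * (1 + M + M))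
    (ENNReal.mul_lt_top ENNReal.ofReal_lt_top (by simp [ENNReal.add_lt_top, hM]))
  filter_upwards [eventually_ge_atTop (3 * P.T)] with t ht
  exact hbound t ht

theorem mainTheorem4
    {q p m_u k n : ℕ} (hn : 0 < n) (ℓ : Fin q → ℕ) (a : (i : Fin q) → Fin (ℓ i) → ℝ)
    (F : Matrix (BlockIndex ℓ) (BlockIndex ℓ) ℝ) (G : Matrix (BlockIndex ℓ) (Fin m_u) ℝ)
    (H : Matrix (Fin q ⊕ Fin p) (BlockIndex ℓ) ℝ)
    (hFH : IsBlockObservableForm a F H) (hFG : IsControllable F G)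
    (hF : 1 < matrixSpectralRadius F) (X₀ W V R β : ℝ)
    (hR : 1 / (n : ℝ) * ∑ i, max 0 (Real.logb 2 (∑ j, |a i j|)) < R)
    (hβ : 2 / (n : ℝ) * Real.logb 2 (matrixSpectralRadius (matrixAbs F)) < β) :
    ∃ (obs : CausalObserver k (Fin q ⊕ Fin p)) (ctrl : CausalController k (Fin m_u)),
      ∀ (Z : Type v) [MeasurableSpace Z] (ch : CausalChannel n Z) (code : CausalCode k n Z),
        IsAnytimeCode.{u, v} ch code R β →
        ∀ (Ω : Type u) [MeasurableSpace Ω] (μ : Measure Ω) [IsProbabilityMeasure μ]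
          (w : ℕ → Ω → BlockIndex ℓ → ℝ) (v : ℕ → Ω → Fin q ⊕ Fin p → ℝ)
          (x : ℕ → Ω → BlockIndex ℓ → ℝ) (y : ℕ → Ω → Fin q ⊕ Fin p → ℝ)
          (u : ℕ → Ω → Fin m_u → ℝ) (b : ℕ → Ω → Message k) (z : ℕ → Ω → Fin n → Z),
          IsClosedLoop F G H X₀ W V obs ctrl ch code μ w v x y u b z →
            IsMeanSquareStable μ x := by
  by_cases hRk : R = (k : ℝ) / n
  · obtain ⟨r, c, hr, hrβ, hc, hgrowth⟩ := exists_growth_rate F hn β hF hβ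
    have hc : 0 ≤ c := by linarith
    rw [hRk] at hR
    obtain ⟨wt, ct, hwt, hct, hFw, hprod⟩ := hFH.exists_weights _ (prod_max_one_lt_two_pow hn _ hR)
    obtain ⟨N, L, hL⟩ := exists_observability_leftInverse F H hFH.eq_zero
    obtain ⟨T, hT, hTN, hTcard, hT0⟩ :=
      ((exists_lattice_coloring F wt ct hwt hct hFw _ hprod).and
        ((eventually_ge_atTop N).and ((eventually_ge_atTop (Fintype.card (BlockIndex ℓ))).and
          (eventually_gt_atTop 0)))).exists
    -- A colour is a word of T messages, so there are (2^k)^T colours.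
    obtain ⟨col, hcol⟩ := hT (Fin T → Message k) (by simp)
    obtain ⟨S, hS⟩ := hFG.exists_rightInverse T hTcard
    obtain ⟨P, hP⟩ := LoopDesign.exists_isAdequate F G H X₀ W V hc hr.le hgrowth hT0 hTN L hL S hS
      col hcol
    exact ⟨P.observer, P.controller F G H, fun Z _ ch code hcode Ω _ μ _ w v x y u b z h =>
      hP.isMeanSquareStable hc hr hgrowth hcode hrβ h⟩
  -- If R is not k / n, no code qualifies and any observer and controller will do.
  · exact ⟨⟨fun _ _ => default, fun _ => measurable_const⟩, ⟨0, fun _ _ => 0⟩,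
      fun Z _ ch code hcode => absurd hcode.choose_spec.2.1 hRk⟩
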